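/- **Model.** Let $k,m,Q,S$ be natural numbers. Each component $i\in\{1,\dots,k\}$ is either continuous, binary or a count; $\mu_i$ is accordingly the Lebesgue measure on $\mathbb R$, the counting measure on $\{0,1\}$ or the counting measure on $\mathbb N$, and $\mu=\mu_1\otimes\cdots\otimes\mu_k$. Let $G_i\subset\mathbb R$ be Borel sets, $G=G_1\times\cdots\times G_k$, and for $s_i\in G_i$ let $P_i(\cdot\mid s_i)$ be a probability distribution with density $p_i(\cdot\mid s_i)$ with respect to $\mu_i$ (jointly measurable in $(y,s_i)$), cumulative distribution function $F_{i,s_i}$ and generalized inverse $F_{i,s_i}^{-1}$. Let $\Theta\subset\mathbb R^Q$, $\Gamma\subset\mathbb R^S$, and for $R\in\Gamma$ let $c_R$ be the density of a copula $C_R$, i.e. of a probability distribution on $[0,1]^k$ with uniform marginals. For $s\in G$ let $$p_R(y\mid s)=\prod_{i\ \text{continuous}}p_i(y_i\mid s_i)\ \int_{\prod_{i\ \text{discrete}}(F_{i,s_i}(y_i^-),F_{i,s_i}(y_i)]}c_R(u)\prod_{i\ \text{discrete}}du_i,$$ where $u_i=F_{i,s_i}(y_i)$ for the continuous components, and $P_R(A\mid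 s)=\int_A p_R(y\mid s)\,\mu(dy)$. For $\theta\in\Theta$ let $g_\theta$ be a measurable function. Let $\theta_0\in\Theta$, $R_0\in\Gamma$, let $(U_t)_{t\in\mathbb Z}$, $(X_t)_{t\in\mathbb Z}$ be processes in $\mathbb R^k$, $\mathbb R^m$, and $\mathcal F_t=\sigma((U_s,X_s):s\le t)$. Assume that $((U_t,X_t))_{t\in\mathbb Z}$ is stationary and ergodic and that, for every $t$, $U_t$ is independent of $\mathcal F_{t-1}$ and has distribution $C_{R_0}$. Let $Y_t$ and the $G$-valued $\lambda_t(\theta)$, $\theta\in\Theta$, satisfy almost surely, for all $t\in\mathbb Z$, $$Y_{i,t}=F^{-1}_{i,\lambda_{i,t}(\theta_0)}(U_{i,t}),\ 1\le i\le k,\qquad \lambda_t(\theta)=g_\theta(\lambda_{t-1}(\theta),Y_{t-1},X_{t-1}),\ \theta\in\Theta,$$ where $(Y_t,\lambda_t(\theta_0))$ is $(\mathcal F_t)$-adapted and the process $(Y_t,X_t,(\lambda_t(\theta))_{\theta\in\Theta})_{t\in\mathbb Z}$ is stationary and ergodic. Let $$f_t(\theta,R)=\log p_R(Y_t\mid\lambda_t(\theta)),\qquad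 \bar f(\theta,R)=\mathbb E f_1(\theta,R),\qquad \mathcal I_0=\{R\in\Gamma:\bar f(\theta_0,R)=\bar f(\theta_0,R_0)\}.$$ **Assumptions.** * (A13) $\Theta$ and $\Gamma$ are compact. * (A14) For every $t$, almost surely $(\theta,R)\mapsto f_t(\theta,R)$ is continuous on $\Theta\times\Gamma$, and $\mathbb E\sup_{(\theta,R)\in\Theta\times\Gamma}|f_1(\theta,R)|<\infty$. * (A15) $\bar f(\theta_0,R_0)\ge\bar f(\theta_0,R)$ for all $R\in\Gamma$. * (A16) For every $\lambda\in G$ the map $R\mapsto\int\log(p_R(y\mid\lambda))\,p_{R_0}(y\mid\lambda)\,\mu(dy)$ is well defined (the integral converges absolutely) and continuous on $\Gamma$. Let $\hat\theta=\hat\theta_n\in\Theta$ be such that $\hat\theta_n\to\theta_0$ almost surely, and let $\hat R=\hat R_n\in\Gamma$ be a maximizer over $R\in\Gamma$ of $\frac1n\sum_{t=1}^n f_t(\hat\theta_n,R)$, $n\ge1$. **Proposition.** Under these assumptions, $\lim_{n\to\infty}d(\hat R_n,\mathcal I_0)=0$ almost surely, where $d(R,\mathcal I_0)$ is the Euclidean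 distance from $R$ to $\mathcal I_0$. Moreover, there is a Borel set $\Lambda\subset G$ with $\mathbb P(\lambda_0(\theta_0)\in\Lambda)=1$ such that, for every $s\in\Lambda$, $$d_{TV}\big(P_{\hat R_n}(\cdot\mid s),P_{R_0}(\cdot\mid s)\big)\to0\quad\text{almost surely as }n\to\infty,$$ where $d_{TV}(\nu,\nu')=\sup_A|\nu(A)-\nu'(A)|$ over Borel sets $A$. -/

import Mathlib

open MeasureTheory ProbabilityTheory Filter Topology
open scoped ENNReal

noncomputable section

namespace MixedSeries

/-! ### Stationary ergodic processes and total variation -/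

/-- A process indexed by `ℤ` is stationary and ergodic: its law on the path space is invariant and
ergodic for the shift. -/
structure IsStationaryErgodic {Ω S : Type*} [MeasurableSpace Ω] [MeasurableSpace S]
    (Z : ℤ → Ω → S) (P : Measure Ω) : Prop where
  measurable : ∀ t, Measurable (Z t)
  ergodic : Ergodic (fun (x : ℤ → S) (t : ℤ) => x (t + 1)) (P.map fun ω t => Z t ω)

/-- The total variation distance `sup_A |ν(A) - ν'(A)|` over measurable sets `A`
(used for probability measures only). -/
def tvDist {F : Type*} [MeasurableSpace F] (ν ν' : Measure F) : ℝ :=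
  ⨆ A : {A : Set F // MeasurableSet A}, |ν.real A - ν'.real A|

/-! ### Copulas with a density -/

/-- The measure on `[0,1]^k` with density `c` with respect to the Lebesgue measure. -/
def copulaMeasure {k : ℕ} (c : (Fin k → ℝ) → ℝ≥0∞) : Measure (Fin k → ℝ) :=
  (volume.restrict (Set.univ.pi fun _ => Set.Icc (0 : ℝ) 1)).withDensity c

/-- `c` is the density of a copula: a probability distribution on `[0,1]^k` all of whose
one-dimensional marginals are uniform on `[0,1]`. -/
structure IsCopulaDensity {k : ℕ} (c : (Fin k → ℝ) → ℝ≥0∞) : Prop where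
  measurable : Measurable c
  isProbabilityMeasure : IsProbabilityMeasure (copulaMeasure c)
  uniform_marginal : ∀ i,
    (copulaMeasure c).map (fun u => u i) = volume.restrict (Set.Icc (0 : ℝ) 1)

/-! ### The model -/

/-- The nature of a component of the time series: state space `ℝ`, `{0,1}` or `ℕ`. -/
inductive Kind
  | continuous
  | binary
  | count

/-- Is the component binary or a count? -/
def Kind.isDiscrete : Kind → Bool
  | .continuous => false
  | .binary => true
  | .count => true

/-- The reference measure of a component, as a measure on `ℝ`: the Lebesgue measure, the counting
measure on `{0,1}`, or the counting measure on `ℕ`. -/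
def Kind.refMeasure : Kind → Measure ℝ
  | .continuous => volume
  | .binary => Measure.dirac 0 + Measure.dirac 1
  | .count => Measure.sum fun n : ℕ => Measure.dirac (n : ℝ)

/-- The parametric copula model for mixed time series with `k` components, `m` covariates,
autoregressive parameter `θ ∈ Θ ⊆ ℝ^Q` and copula parameter `R ∈ Γ ⊆ ℝ^S`. -/
structure Model (k m Q S : ℕ) where
  /-- The nature of each component. -/
  kind : Fin k → Kind
  /-- The state spaces of the latent processes. -/
  G : Fin k → Set ℝ
  measurableSet_G : ∀ i, MeasurableSet (G i)
  /-- `dens i s y` is the density `p_i(y | s)` of the `i`-th marginal distribution `P_i(· | s)`. -/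
  dens : Fin k → ℝ → ℝ → ℝ≥0∞
  measurable_dens : ∀ i, Measurable fun q : ℝ × ℝ => dens i q.1 q.2
  lintegral_dens : ∀ i, ∀ s ∈ G i, ∫⁻ y, dens i s y ∂(kind i).refMeasure = 1
  /-- The set of autoregressive parameters. -/
  Θ : Set (EuclideanSpace ℝ (Fin Q))
  /-- The set of copula parameters. -/
  Γ : Set (EuclideanSpace ℝ (Fin S))
  /-- The copula densities `c_R`. -/
  copula : EuclideanSpace ℝ (Fin S) → (Fin k → ℝ) → ℝ≥0∞
  isCopulaDensity : ∀ R ∈ Γ, IsCopulaDensity (copula R)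
  /-- The autoregressive function: `g θ λ y x` is `g_θ(λ, y, x)`. -/
  g : EuclideanSpace ℝ (Fin Q) → (Fin k → ℝ) → (Fin k → ℝ) → (Fin m → ℝ) → (Fin k → ℝ)
  measurable_g : ∀ θ ∈ Θ, Measurable
    fun q : (Fin k → ℝ) × (Fin k → ℝ) × (Fin m → ℝ) => g θ q.1 q.2.1 q.2.2

namespace Model

variable {k m Q S : ℕ} (M : Model k m Q S)

/-- The set `G_1 × ⋯ × G_k`. -/
def latentSpace : Set (Fin k → ℝ) := Set.univ.pi M.G

/-- The marginal distribution `P_i(· | s)`. -/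
def marginal (i : Fin k) (s : ℝ) : Measure ℝ :=
  (M.kind i).refMeasure.withDensity (M.dens i s)

/-- The cumulative distribution function `F_{i,s}` of `P_i(· | s)`. -/
def margCdf (i : Fin k) (s : ℝ) (y : ℝ) : ℝ := cdf (M.marginal i s) y

/-- The left limit `F_{i,s}(y⁻)`. -/
def margCdfLeft (i : Fin k) (s : ℝ) (y : ℝ) : ℝ := Function.leftLim (cdf (M.marginal i s)) y

/-- The generalized inverse `F_{i,s}^{-1}` (of interest on `(0,1)`). -/
def quantile (i : Fin k) (s : ℝ) (u : ℝ) : ℝ := sInf {y | u ≤ M.margCdf i s y}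

/-- The product reference measure `μ` on `ℝ^k`. -/
def refMeasure : Measure (Fin k → ℝ) := Measure.pi fun i => (M.kind i).refMeasure

/-- The conditional density `p_R(y | s)`: the product of the densities `p_i(y_i | s_i)` of the
continuous components, times the integral of `c_R` in which each discrete coordinate `u_i` runs
over `(F_{i,s_i}(y_i⁻), F_{i,s_i}(y_i)]` and each continuous coordinate is fixed at
`F_{i,s_i}(y_i)`. -/
def condDensity (R : EuclideanSpace ℝ (Fin S)) (s y : Fin k → ℝ) : ℝ≥0∞ :=
  (∏ i with (M.kind i).isDiscrete = false, M.dens i (s i) (y i)) *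
    lmarginal
      (fun i => volume.restrict (Set.Ioc (M.margCdfLeft i (s i) (y i)) (M.margCdf i (s i) (y i))))
      (Finset.univ.filter fun i => (M.kind i).isDiscrete = true)
      (M.copula R)
      (fun i => M.margCdf i (s i) (y i))

/-- The conditional distribution `P_R(· | s)`, with density `p_R(· | s)` with respect to `μ`. -/
def condDist (R : EuclideanSpace ℝ (Fin S)) (s : Fin k → ℝ) : Measure (Fin k → ℝ) :=
  M.refMeasure.withDensity (M.condDensity R s)

/-- `log p_R(y | s)`, with `log 0 = -∞`. -/
def logDensity (R : EuclideanSpace ℝ (Fin S)) (s y : Fin k → ℝ) : EReal :=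
  ENNReal.log (M.condDensity R s y)

end Model

/-! ### Stationary solutions -/

/-- The sigma-field `ℱ_t` generated by `(U_s, X_s)`, `s ≤ t`. -/
abbrev past {k m : ℕ} {Ω : Type*} (U : ℤ → Ω → (Fin k → ℝ)) (X : ℤ → Ω → (Fin m → ℝ)) (t : ℤ) :
    MeasurableSpace Ω :=
  ⨆ s : {s : ℤ // s ≤ t}, MeasurableSpace.comap (fun ω => (U s ω, X s ω)) inferInstance

/-- The standing framework: `U` and `X` are the noise and covariate processes, `Y` is the observed
process, and `lam t θ` is `λ_t(θ)`, the latent process at the parameter value `θ`; the observations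
are generated by the model with true parameters `θ₀` and `R₀`. -/
structure IsStationarySolution {k m Q S : ℕ} (M : Model k m Q S) {Ω : Type*} [MeasurableSpace Ω]
    (P : Measure Ω) (θ₀ : EuclideanSpace ℝ (Fin Q)) (R₀ : EuclideanSpace ℝ (Fin S))
    (U : ℤ → Ω → (Fin k → ℝ)) (X : ℤ → Ω → (Fin m → ℝ)) (Y : ℤ → Ω → (Fin k → ℝ))
    (lam : ℤ → EuclideanSpace ℝ (Fin Q) → Ω → (Fin k → ℝ)) : Prop where
  θ₀_mem : θ₀ ∈ M.Θ
  R₀_mem : R₀ ∈ M.Γ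
  /-- The pair (noise, covariates) is stationary and ergodic. -/
  inputs_stationaryErgodic : IsStationaryErgodic (fun t ω => (U t ω, X t ω)) P
  /-- `U_t` is independent of `ℱ_{t-1}`. -/
  noise_indep : ∀ t, Indep (MeasurableSpace.comap (U t) inferInstance) (past U X (t - 1)) P
  /-- `U_t` is distributed according to the copula `C_{R₀}`. -/
  noise_law : ∀ t, P.map (U t) = copulaMeasure (M.copula R₀)
  /-- The latent processes take their values in `G_1 × ⋯ × G_k`. -/
  latent_mem : ∀ t, ∀ θ ∈ M.Θ, ∀ ω, lam t θ ω ∈ M.latentSpace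
  /-- `Y_{i,t} = F_{i,λ_{i,t}}^{-1}(U_{i,t})`, where `λ_t = λ_t(θ₀)`. -/
  observation_eq : ∀ t, ∀ᵐ ω ∂P, ∀ i, Y t ω i = M.quantile i (lam t θ₀ ω i) (U t ω i)
  /-- `λ_t(θ) = g_θ(λ_{t-1}(θ), Y_{t-1}, X_{t-1})`. -/
  latent_eq : ∀ t, ∀ θ ∈ M.Θ, ∀ᵐ ω ∂P,
    lam t θ ω = M.g θ (lam (t - 1) θ ω) (Y (t - 1) ω) (X (t - 1) ω)
  /-- The solution `(Y_t, λ_t(θ₀))` is adapted to `(ℱ_t)`. -/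
  adapted : ∀ t, Measurable[past U X t] fun ω => (Y t ω, lam t θ₀ ω)
  /-- The process `(Y_t, X_t, (λ_t(θ))_{θ ∈ Θ})` is stationary and ergodic. -/
  solution_stationaryErgodic :
    IsStationaryErgodic (fun t ω => (Y t ω, X t ω, fun θ : M.Θ => lam t θ ω)) P

/-! ### The likelihood of the copula parameter -/

section Likelihood

variable {k m Q S : ℕ} (M : Model k m Q S) {Ω : Type*} (Y : ℤ → Ω → (Fin k → ℝ))
  (lam : ℤ → EuclideanSpace ℝ (Fin Q) → Ω → (Fin k → ℝ))

/-- `f_t(θ, R) = log p_R(Y_t | λ_t(θ))`. -/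
def logLik (t : ℤ) (θ : EuclideanSpace ℝ (Fin Q)) (R : EuclideanSpace ℝ (Fin S)) (ω : Ω) : EReal :=
  M.logDensity R (lam t θ ω) (Y t ω)

/-- The criterion `(1/n) ∑_{t=1}^n f_t(θ, R)`. -/
def avgLogLik (n : ℕ) (θ : EuclideanSpace ℝ (Fin Q)) (R : EuclideanSpace ℝ (Fin S)) (ω : Ω) :
    EReal :=
  (∑ t ∈ Finset.Icc 1 n, logLik M Y lam (t : ℤ) θ R ω) / (n : EReal)

variable [MeasurableSpace Ω] (P : Measure Ω)

/-- `f̄(θ, R) = E f_1(θ, R)`; used when `E |f_1(θ, R)| < ∞`, so that `f_1(θ, R)` is a.s. finite. -/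
def meanLogLik (θ : EuclideanSpace ℝ (Fin Q)) (R : EuclideanSpace ℝ (Fin S)) : ℝ :=
  ∫ ω, (logLik M Y lam 1 θ R ω).toReal ∂P

/-- The set `I₀ = {R ∈ Γ : f̄(θ₀, R) = f̄(θ₀, R₀)}`. -/
def optimalSet (θ₀ : EuclideanSpace ℝ (Fin Q)) (R₀ : EuclideanSpace ℝ (Fin S)) :
    Set (EuclideanSpace ℝ (Fin S)) :=
  {R ∈ M.Γ | meanLogLik M Y lam P θ₀ R = meanLogLik M Y lam P θ₀ R₀}

end Likelihood

end MixedSeries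

end

/-! The estimator is located by Wald's argument, and the total variation statement follows by
comparing relative entropies.

Away from `I₀` the mean criterion is strictly below its value at `R₀`. By compactness of `Γ`,
finitely many balls cover the parameters at distance at least `δ` from `I₀`. On each of them,
uniformly for `θ` near `θ₀`, the averages are eventually below those at `R₀`, so no such parameter
can be a maximizer (`IsRegularCriterion.exists_ball_sum_lt`). Only upper bounds for averages are
needed, applied to `f` and `-f`. They follow from one fact: under an ergodic map, the Birkhoff sums
of a function with negative integral are almost surely bounded above (`ae_bddAbove_birkhoffSum`). It
is applied to suprema of the criterion over small balls.

For the conditional laws, the key is that `Y_t` given `λ_t(θ₀) = s` has law `P_{R₀}(· | s)`. Since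
`U_t` is independent of the past, this amounts to `P_R(· | s)` being the image of the copula under
the marginal quantile functions (`Model.condDist_eq_map`). That identity rests on the distributional
transform: if `Y` has distribution function `F` and `V` is an independent uniform variable, then
`(Y, F(Y⁻) + V (F(Y) - F(Y⁻)))` has the law of `(F⁻¹(U), U)` with `U` uniform.

Hence `f̄(θ₀, R₀) - f̄(θ₀, R)` is the mean over `s` of the relative entropy of `P_{R₀}(· | s)` with
respect to `P_R(· | s)`. For `R ∈ I₀` this mean of a nonnegative quantity is zero, so the entropy
vanishes for almost every `s`. A countable dense subset of `I₀` and continuity in `R` give a single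
null set of `s` for all of `I₀`. Outside it the entropy at `R̂_n` tends to zero, and a Pinsker-type
inequality (`entropy_bounds`) concludes. -/

namespace MixedSeries

/-! ### One-sided pointwise ergodic theorem -/

/-- The running maximum `max_{j ≤ n} S_j` of the Birkhoff sums of `g`, defined recursively. -/
def maxBirkhoffSum {α : Type*} (T : α → α) (g : α → ℝ) : ℕ → α → ℝ
  | 0, _ => 0
  | n + 1, x => max 0 (g x + maxBirkhoffSum T g n (T x))

section Birkhoff

variable {α : Type*} {T : α → α} {g : α → ℝ}

lemma maxBirkhoffSum_nonneg (n : ℕ) (x : α) : 0 ≤ maxBirkhoffSum T g n x := by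
  cases n with
  | zero => exact le_rfl
  | succ n => exact le_max_left _ _

lemma birkhoffSum_le_maxBirkhoffSum (n : ℕ) (x : α) :
    birkhoffSum T g n x ≤ maxBirkhoffSum T g n x := by
  induction n generalizing x with
  | zero => simp [maxBirkhoffSum]
  | succ n ih =>
    rw [birkhoffSum_succ']
    exact (add_le_add_right (ih (T x)) _).trans (le_max_right _ _)

lemma maxBirkhoffSum_le_succ (n : ℕ) (x : α) :
    maxBirkhoffSum T g n x ≤ maxBirkhoffSum T g (n + 1) x := by
  induction n generalizing x with
  | zero => exact maxBirkhoffSum_nonneg 1 x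
  | succ n ih => exact max_le_max le_rfl (add_le_add_right (ih (T x)) _)

lemma monotone_maxBirkhoffSum (x : α) : Monotone fun n => maxBirkhoffSum T g n x :=
  monotone_nat_of_le_succ fun n => maxBirkhoffSum_le_succ n x

/-- The recursion bounds each of the two maxima by the other up to the finite number `g x`.
Boundedness is thus a shift-invariant event, to which the zero-one law for ergodic maps applies. -/
lemma bddAbove_maxBirkhoffSum_comp_iff (x : α) :
    BddAbove (Set.range fun n => maxBirkhoffSum T g n (T x)) ↔
      BddAbove (Set.range fun n => maxBirkhoffSum T g n x) := by
  constructor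
  · rintro ⟨C, hC⟩
    refine ⟨max 0 (g x + C), ?_⟩
    rintro _ ⟨n, rfl⟩
    refine (maxBirkhoffSum_le_succ n x).trans (max_le_max le_rfl ?_)
    exact add_le_add_right (hC ⟨n, rfl⟩) _
  · rintro ⟨C, hC⟩
    refine ⟨C - g x, ?_⟩
    rintro _ ⟨n, rfl⟩
    have h1 : maxBirkhoffSum T g (n + 1) x ≤ C := hC ⟨n + 1, rfl⟩
    have h2 := (le_max_right 0 (g x + maxBirkhoffSum T g n (T x))).trans h1
    change maxBirkhoffSum T g n (T x) ≤ _
    linarith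

/-- The difference equals `max (-M_n(Tx)) (g x)` with `M_n(Tx) ≥ 0`. This provides the dominating
function; when `M_n(Tx)` tends to infinity, the difference is eventually `g x`. -/
lemma abs_maxBirkhoffSum_succ_sub_le (n : ℕ) (x : α) :
    |maxBirkhoffSum T g (n + 1) x - maxBirkhoffSum T g n (T x)| ≤ |g x| := by
  have h := maxBirkhoffSum_nonneg (T := T) (g := g) n (T x)
  simp only [maxBirkhoffSum]
  rcases le_total 0 (g x + maxBirkhoffSum T g n (T x)) with h0 | h0
  · rw [max_eq_right h0]; simp
  · rw [max_eq_left h0, zero_sub, abs_neg, abs_of_nonneg h, abs_of_nonpos (by linarith)]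
    linarith

lemma tendsto_maxBirkhoffSum_succ_sub (x : α)
    (hx : ¬ BddAbove (Set.range fun n => maxBirkhoffSum T g n x)) :
    Tendsto (fun n => maxBirkhoffSum T g (n + 1) x - maxBirkhoffSum T g n (T x)) atTop
      (𝓝 (g x)) := by
  have h1 : Tendsto (fun n => maxBirkhoffSum T g n (T x)) atTop atTop :=
    tendsto_atTop_atTop_of_monotone' (monotone_maxBirkhoffSum (T x))
      (by rwa [bddAbove_maxBirkhoffSum_comp_iff])
  refine tendsto_const_nhds.congr' ?_
  filter_upwards [h1.eventually_ge_atTop (-g x)] with n hn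
  simp only [maxBirkhoffSum]
  rw [max_eq_right (by linarith)]
  ring

variable [MeasurableSpace α] {μ : Measure α}

lemma measurable_maxBirkhoffSum (hT : Measurable T) (hg : Measurable g) (n : ℕ) :
    Measurable (maxBirkhoffSum T g n) := by
  induction n with
  | zero => exact measurable_const
  | succ n ih => exact measurable_const.max (hg.add (ih.comp hT))

lemma integrable_maxBirkhoffSum (hT : MeasurePreserving T μ μ) (hg : Integrable g μ) (n : ℕ) :
    Integrable (maxBirkhoffSum T g n) μ := by
  induction n with
  | zero => exact integrable_zero _ _ _
  | succ n ih => exact (integrable_zero _ _ _).sup (hg.add (hT.integrable_comp_of_integrable ih))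

/-- The Birkhoff sums of a function with negative integral are almost surely bounded above. -/
lemma ae_bddAbove_birkhoffSum [IsProbabilityMeasure μ] (hT : Ergodic T μ) (hgm : Measurable g)
    (hg : Integrable g μ) (hneg : ∫ x, g x ∂μ < 0) :
    ∀ᵐ x ∂μ, BddAbove (Set.range fun n => birkhoffSum T g n x) := by
  have hTp := hT.toMeasurePreserving
  set A : Set α := {x | BddAbove (Set.range fun n => maxBirkhoffSum T g n x)} with hA
  have hAm : MeasurableSet A :=
    measurableSet_bddAbove_range fun n => measurable_maxBirkhoffSum hTp.measurable hgm n
  have hAinv : T ⁻¹' A = A := by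
    ext x
    exact bddAbove_maxBirkhoffSum_comp_iff x
  rcases hT.toPreErgodic.ae_empty_or_univ hAm hAinv with h | h
  · exfalso
    have hunb : ∀ᵐ x ∂μ, x ∉ A := by
      filter_upwards [h] with x hx hxA
      exact (hx.mp hxA)
    -- If the maxima were unbounded almost everywhere, dominated convergence would give the limit `∫
    -- g < 0`. By invariance of `μ` these integrals equal `∫ (M_{n+1} - M_n) ≥ 0`, a contradiction.
    have hlim : Tendsto (fun n => ∫ x, (maxBirkhoffSum T g (n + 1) x
        - maxBirkhoffSum T g n (T x)) ∂μ) atTop (𝓝 (∫ x, g x ∂μ)) := by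
      refine tendsto_integral_of_dominated_convergence (fun x => |g x|) ?_ hg.abs ?_ ?_
      · intro n
        exact ((measurable_maxBirkhoffSum hTp.measurable hgm (n + 1)).sub
          ((measurable_maxBirkhoffSum hTp.measurable hgm n).comp
            hTp.measurable)).aestronglyMeasurable
      · intro n
        exact Eventually.of_forall fun x => abs_maxBirkhoffSum_succ_sub_le n x
      · filter_upwards [hunb] with x hx
        exact tendsto_maxBirkhoffSum_succ_sub x hx
    refine absurd (ge_of_tendsto' hlim fun n => ?_) (not_le.mpr hneg)
    have hi := integrable_maxBirkhoffSum hTp hg n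
    have hc : ∫ x, maxBirkhoffSum T g n (T x) ∂μ = ∫ x, maxBirkhoffSum T g n x ∂μ := by
      have := integral_map (μ := μ) hTp.measurable.aemeasurable (f := maxBirkhoffSum T g n)
        (by rw [hTp.map_eq]; exact hi.aestronglyMeasurable)
      rw [← this, hTp.map_eq]
    have hic : Integrable (fun x => maxBirkhoffSum T g n (T x)) μ :=
      hTp.integrable_comp_of_integrable hi
    rw [integral_sub (integrable_maxBirkhoffSum hTp hg (n + 1)) hic, hc, sub_nonneg]
    exact integral_mono hi (integrable_maxBirkhoffSum hTp hg (n + 1))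
      fun x => maxBirkhoffSum_le_succ n x
  · filter_upwards [h] with x hx
    obtain ⟨C, hC⟩ : x ∈ A := hx.mpr trivial
    refine ⟨C, ?_⟩
    rintro _ ⟨n, rfl⟩
    exact (birkhoffSum_le_maxBirkhoffSum n x).trans (hC ⟨n, rfl⟩)

end Birkhoff

namespace IsStationaryErgodic

variable {Ω W : Type*} [MeasurableSpace Ω] [MeasurableSpace W] {Z : ℤ → Ω → W} {P : Measure Ω}

lemma measurable_path (hZ : IsStationaryErgodic Z P) : Measurable fun ω t => Z t ω :=
  measurable_pi_lambda _ hZ.measurable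

lemma map_succ (hZ : IsStationaryErgodic Z P) (t : ℤ) :
    P.map (Z (t + 1)) = P.map (Z t) := by
  have h := hZ.ergodic.toMeasurePreserving.map_eq
  have h2 := congrArg (fun ν => ν.map fun x : ℤ → W => x t) h
  rw [Measure.map_map (measurable_pi_apply t) hZ.ergodic.measurable,
    Measure.map_map ((measurable_pi_apply t).comp hZ.ergodic.measurable) hZ.measurable_path,
    Measure.map_map (measurable_pi_apply t) hZ.measurable_path] at h2
  exact h2

/-- The one-dimensional laws of a stationary process coincide. -/
lemma map_eq (hZ : IsStationaryErgodic Z P) (s t : ℤ) : P.map (Z s) = P.map (Z t) := by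
  have h : ∀ t, P.map (Z t) = P.map (Z 0) := by
    intro t
    induction t with
    | zero => rfl
    | succ n ih => rw [hZ.map_succ, ih]
    | pred n ih => rw [← ih, ← hZ.map_succ, sub_add_cancel]
  rw [h s, h t]

lemma ae_comp_of_ae (hZ : IsStationaryErgodic Z P) {p : W → Prop} (hp : MeasurableSet {w | p w})
    {s : ℤ} (h : ∀ᵐ ω ∂P, p (Z s ω)) (t : ℤ) : ∀ᵐ ω ∂P, p (Z t ω) := by
  have h1 : ∀ᵐ w ∂(P.map (Z s)), p w := (ae_map_iff (hZ.measurable s).aemeasurable hp).2 h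
  rw [hZ.map_eq s t] at h1
  exact (ae_map_iff (hZ.measurable t).aemeasurable hp).1 h1

/-- One-sided pointwise ergodic theorem. -/
lemma ae_eventually_sum_le [IsProbabilityMeasure P] (hZ : IsStationaryErgodic Z P) {φ : W → ℝ}
    (hφ : Measurable φ) (hint : Integrable (fun ω => φ (Z 1 ω)) P) {c : ℝ}
    (hc : ∫ ω, φ (Z 1 ω) ∂P < c) :
    ∀ᵐ ω ∂P, ∀ᶠ n : ℕ in atTop, ∑ t ∈ Finset.Icc 1 n, φ (Z (t : ℤ) ω) ≤ n * c := by
  -- Centring at `d < c` makes the integral negative; the margin `c - d` absorbs the random bound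
  -- `C` for large `n`.
  obtain ⟨d, hd1, hd2⟩ := exists_between hc
  set ν := P.map fun ω t => Z t ω
  have hpm := hZ.measurable_path
  have : IsProbabilityMeasure ν := Measure.isProbabilityMeasure_map hpm.aemeasurable
  set g : (ℤ → W) → ℝ := fun x => φ (x 1) - d
  have hgm : Measurable g := (hφ.comp (measurable_pi_apply 1)).sub_const d
  have hgi : Integrable g ν := by
    rw [integrable_map_measure hgm.aestronglyMeasurable hpm.aemeasurable]
    exact hint.sub (integrable_const d)
  have hgneg : ∫ x, g x ∂ν < 0 := by
    rw [integral_map hpm.aemeasurable hgm.aestronglyMeasurable]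
    simp only [g]
    rw [integral_sub hint (integrable_const d)]
    simp
    linarith
  have h := ae_of_ae_map hpm.aemeasurable (ae_bddAbove_birkhoffSum hZ.ergodic hgm hgi hgneg)
  filter_upwards [h] with ω ⟨C, hC⟩
  -- Reading coordinate `1` rather than `0` makes the first `n` Birkhoff terms the times `1, …, n`.
  have hiter : ∀ (n : ℕ) (x : ℤ → W),
      (fun (x : ℤ → W) (t : ℤ) => x (t + 1))^[n] x 1 = x ((n + 1 : ℕ) : ℤ) := by
    intro n
    induction n with
    | zero => intro x; simp
    | succ n ih => intro x; rw [Function.iterate_succ_apply, ih]; push_cast; rfl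
  have hsum : ∀ n : ℕ, ∑ t ∈ Finset.Icc 1 n, φ (Z (t : ℤ) ω) ≤ C + n * d := by
    intro n
    have h1 := hC ⟨n, rfl⟩
    simp only [birkhoffSum, g, hiter, Finset.sum_sub_distrib, Finset.sum_const,
      Finset.card_range, nsmul_eq_mul] at h1
    have h2 : ∑ t ∈ Finset.Icc 1 n, φ (Z (t : ℤ) ω)
        = ∑ j ∈ Finset.range n, φ (Z ((j + 1 : ℕ) : ℤ) ω) := by
      rw [Finset.range_eq_Ico, Finset.sum_Ico_add' (fun t : ℕ => φ (Z (t : ℤ) ω)) 0 n 1]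
      rfl
    rw [h2]
    linarith
  have hev := (tendsto_natCast_atTop_atTop (R := ℝ)).eventually_ge_atTop (C / (c - d))
  filter_upwards [hev] with n hn
  refine (hsum n).trans ?_
  rw [div_le_iff₀ (by linarith)] at hn
  linarith

end IsStationaryErgodic

/-! ### Uniform upper bounds for averages and Wald's consistency argument -/

/-- The supremum of `f q w` over the `q` in a dense sequence within distance `r` of `q₀`. -/
noncomputable def localSup {W E : Type*} [PseudoMetricSpace E] [TopologicalSpace.SeparableSpace E]
    [Nonempty E] (f : E → W → ℝ) (q₀ : E) (r : ℝ) (w : W) : ℝ :=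
  ⨆ i : {i : ℕ // TopologicalSpace.denseSeq E i ∈ Metric.ball q₀ r},
    f (TopologicalSpace.denseSeq E i) w

section LocalSup

variable {W E : Type*} [PseudoMetricSpace E] [TopologicalSpace.SeparableSpace E] [Nonempty E]
  {f : E → W → ℝ} {q₀ : E} {r : ℝ} {w : W} {b : ℝ}

lemma nonempty_denseSeq_ball (hr : 0 < r) :
    Nonempty {i : ℕ // TopologicalSpace.denseSeq E i ∈ Metric.ball q₀ r} := by
  obtain ⟨i, hi⟩ := (TopologicalSpace.denseRange_denseSeq E).exists_dist_lt q₀ hr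
  exact ⟨⟨i, by rwa [Metric.mem_ball']⟩⟩

lemma measurable_localSup [MeasurableSpace W] (hf : ∀ q, Measurable (f q)) :
    Measurable (localSup f q₀ r) :=
  Measurable.iSup fun _ => hf _

lemma bddAbove_localSup (hb : ∀ q, |f q w| ≤ b) :
    BddAbove (Set.range fun i : {i : ℕ // TopologicalSpace.denseSeq E i ∈ Metric.ball q₀ r} =>
      f (TopologicalSpace.denseSeq E i) w) := by
  refine ⟨b, ?_⟩
  rintro _ ⟨_, rfl⟩
  exact (le_abs_self _).trans (hb _)

/-- By continuity, the points of the ball where `f` exceeds `f q w - ε` form a nonempty open set,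
which the dense sequence meets. The countable supremum is therefore measurable and loses nothing. -/
lemma le_localSup (hc : Continuous fun q => f q w) (hb : ∀ q, |f q w| ≤ b) {q : E}
    (hq : q ∈ Metric.ball q₀ r) : f q w ≤ localSup f q₀ r w := by
  refine le_of_forall_pos_lt_add fun ε hε => ?_
  have hopen : IsOpen (Metric.ball q₀ r ∩ {q' | f q w - ε < f q' w}) :=
    Metric.isOpen_ball.inter (isOpen_lt continuous_const hc)
  obtain ⟨i, hi⟩ := (TopologicalSpace.denseRange_denseSeq E).exists_mem_open hopen
    ⟨q, hq, by simp [hε]⟩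
  have h1 := le_ciSup (bddAbove_localSup (q₀ := q₀) (r := r) hb) ⟨i, hi.1⟩
  have h2 : f q w - ε < _ := hi.2
  have h3 := h2.trans_le h1
  unfold localSup
  linarith

lemma abs_localSup_le (hr : 0 < r) (hc : Continuous fun q => f q w) (hb : ∀ q, |f q w| ≤ b) :
    |localSup f q₀ r w| ≤ b := by
  have := nonempty_denseSeq_ball (q₀ := q₀) hr
  rw [abs_le]
  constructor
  · exact (abs_le.1 (hb q₀)).1.trans (le_localSup hc hb (Metric.mem_ball_self hr))
  · exact ciSup_le fun _ => (le_abs_self _).trans (hb _)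

lemma tendsto_localSup (hc : Continuous fun q => f q w) (hb : ∀ q, |f q w| ≤ b) :
    Tendsto (fun j : ℕ => localSup f q₀ (1 / ((j : ℝ) + 1)) w) atTop (𝓝 (f q₀ w)) := by
  rw [Metric.tendsto_atTop]
  intro ε hε
  obtain ⟨δ, hδ, h⟩ := Metric.continuous_iff.1 hc q₀ (ε / 2) (half_pos hε)
  obtain ⟨N, hN⟩ := exists_nat_one_div_lt hδ
  refine ⟨N, fun j hj => ?_⟩
  have hpos : (0 : ℝ) < 1 / ((j : ℝ) + 1) := Nat.one_div_pos_of_nat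
  have hjδ : 1 / ((j : ℝ) + 1) < δ := (Nat.one_div_le_one_div hj).trans_lt hN
  have := nonempty_denseSeq_ball (q₀ := q₀) hpos
  have h1 : f q₀ w ≤ localSup f q₀ (1 / ((j : ℝ) + 1)) w :=
    le_localSup hc hb (Metric.mem_ball_self hpos)
  have h2 : localSup f q₀ (1 / ((j : ℝ) + 1)) w ≤ f q₀ w + ε / 2 := by
    refine ciSup_le fun i => ?_
    have h3 := h (TopologicalSpace.denseSeq E i) ((Metric.mem_ball.1 i.2).trans hjδ)
    rw [Real.dist_eq] at h3
    linarith [(abs_lt.1 h3).2]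
  rw [Real.dist_eq, abs_lt]
  constructor <;> linarith

end LocalSup

section Wald

variable {Ω W : Type*} [MeasurableSpace Ω] [MeasurableSpace W] {Z : ℤ → Ω → W} {P : Measure Ω}

/-- `f` is a family of measurable criteria which, along the process `Z`, are continuous in the
parameter and dominated by the measurable function `g`, integrable along `Z`. -/
structure IsRegularCriterion {E : Type*} [TopologicalSpace E] (f : E → W → ℝ) (g : W → ℝ)
    (Z : ℤ → Ω → W) (P : Measure Ω) : Prop where
  measurable : ∀ q, Measurable (f q)
  integrable_bound : Integrable (fun ω => g (Z 1 ω)) P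
  regular : ∀ᵐ ω ∂P, ∀ t, Continuous (fun q => f q (Z t ω)) ∧ ∀ q, |f q (Z t ω)| ≤ g (Z t ω)

lemma IsRegularCriterion.neg {E : Type*} [TopologicalSpace E] {f : E → W → ℝ} {g : W → ℝ}
    (h : IsRegularCriterion f g Z P) : IsRegularCriterion (fun q w => -f q w) g Z P where
  measurable q := (h.measurable q).neg
  integrable_bound := h.integrable_bound
  regular := by
    filter_upwards [h.regular] with ω hω t
    exact ⟨(hω t).1.neg, fun q => by rw [abs_neg]; exact (hω t).2 q⟩

/-- Locally uniform one-sided ergodic theorem. -/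
lemma IsRegularCriterion.exists_ball_sum_le [IsProbabilityMeasure P] {E : Type*}
    [PseudoMetricSpace E] [TopologicalSpace.SeparableSpace E] {f : E → W → ℝ} {g : W → ℝ}
    (hf : IsRegularCriterion f g Z P) (hZ : IsStationaryErgodic Z P) (q₀ : E) {c : ℝ}
    (hc : ∫ ω, f q₀ (Z 1 ω) ∂P < c) :
    ∃ δ > 0, ∀ᵐ ω ∂P, ∀ᶠ n : ℕ in atTop, ∀ q ∈ Metric.ball q₀ δ,
      ∑ t ∈ Finset.Icc 1 n, f q (Z (t : ℤ) ω) ≤ n * c := by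
  have : Nonempty E := ⟨q₀⟩
  have hm : ∀ r, Measurable (localSup f q₀ r) := fun r => measurable_localSup hf.measurable
  have hlim : Tendsto (fun j : ℕ => ∫ ω, localSup f q₀ (1 / ((j : ℝ) + 1)) (Z 1 ω) ∂P) atTop
      (𝓝 (∫ ω, f q₀ (Z 1 ω) ∂P)) := by
    refine tendsto_integral_of_dominated_convergence (fun ω => g (Z 1 ω)) ?_
      hf.integrable_bound ?_ ?_
    · exact fun j => ((hm _).comp (hZ.measurable 1)).aestronglyMeasurable
    · intro j
      filter_upwards [hf.regular] with ω hω
      exact abs_localSup_le Nat.one_div_pos_of_nat (hω 1).1 (hω 1).2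
    · filter_upwards [hf.regular] with ω hω
      exact tendsto_localSup (hω 1).1 (hω 1).2
  obtain ⟨j, hj⟩ := (hlim.eventually_lt_const hc).exists
  have hpos : (0 : ℝ) < 1 / ((j : ℝ) + 1) := Nat.one_div_pos_of_nat
  refine ⟨1 / ((j : ℝ) + 1), hpos, ?_⟩
  have hint : Integrable (fun ω => localSup f q₀ (1 / ((j : ℝ) + 1)) (Z 1 ω)) P := by
    refine hf.integrable_bound.mono' ((hm _).comp (hZ.measurable 1)).aestronglyMeasurable ?_
    filter_upwards [hf.regular] with ω hω
    exact abs_localSup_le hpos (hω 1).1 (hω 1).2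
  filter_upwards [hZ.ae_eventually_sum_le (hm _) hint hj, hf.regular] with ω h1 h2
  filter_upwards [h1] with n hn q hq
  exact (Finset.sum_le_sum fun (t : ℕ) _ => le_localSup (h2 (t : ℤ)).1 (h2 (t : ℤ)).2 hq).trans hn

/-- Wald's argument: uniformly for `θ` close to `θ₀`, the criterion at `R₀` eventually exceeds the
criterion at all `R` in a compact set on which the limit criterion is smaller than at `R₀`. -/
theorem IsRegularCriterion.exists_ball_sum_lt [IsProbabilityMeasure P] {E₁ E₂ : Type*}
    [PseudoMetricSpace E₁] [TopologicalSpace.SeparableSpace E₁] [PseudoMetricSpace E₂]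
    [TopologicalSpace.SeparableSpace E₂] {f : E₁ × E₂ → W → ℝ} {g : W → ℝ}
    (hf : IsRegularCriterion f g Z P) (hZ : IsStationaryErgodic Z P) (θ₀ : E₁) (R₀ : E₂)
    {C : Set E₂} (hC : IsCompact C)
    (hlt : ∀ R ∈ C, ∫ ω, f (θ₀, R) (Z 1 ω) ∂P < ∫ ω, f (θ₀, R₀) (Z 1 ω) ∂P) :
    ∃ δ > 0, ∀ᵐ ω ∂P, ∀ᶠ n : ℕ in atTop, ∀ θ ∈ Metric.ball θ₀ δ, ∀ R ∈ C,
      ∑ t ∈ Finset.Icc 1 n, f (θ, R) (Z (t : ℤ) ω)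
        < ∑ t ∈ Finset.Icc 1 n, f (θ, R₀) (Z (t : ℤ) ω) := by
  -- The property passes to subsets and to finite unions (with the smaller radius), so by
  -- compactness it suffices to prove it near each point of `C`.
  refine hC.induction_on (p := fun C => ∃ δ > 0, ∀ᵐ ω ∂P, ∀ᶠ n : ℕ in atTop,
    ∀ θ ∈ Metric.ball θ₀ δ, ∀ R ∈ C, ∑ t ∈ Finset.Icc 1 n, f (θ, R) (Z (t : ℤ) ω)
        < ∑ t ∈ Finset.Icc 1 n, f (θ, R₀) (Z (t : ℤ) ω)) ?_ ?_ ?_ ?_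
  · exact ⟨1, one_pos, by simp⟩
  · rintro s t hst ⟨δ, hδ, h⟩
    refine ⟨δ, hδ, ?_⟩
    filter_upwards [h] with ω hω
    filter_upwards [hω] with n hn θ hθ R hR
    exact hn θ hθ R (hst hR)
  · rintro s t ⟨δ, hδ, h⟩ ⟨δ', hδ', h'⟩
    refine ⟨min δ δ', lt_min hδ hδ', ?_⟩
    filter_upwards [h, h'] with ω hω hω'
    filter_upwards [hω, hω'] with n hn hn' θ hθ R hR
    rcases hR with hR | hR
    · exact hn θ (Metric.ball_subset_ball (min_le_left _ _) hθ) R hR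
    · exact hn' θ (Metric.ball_subset_ball (min_le_right _ _) hθ) R hR
  · intro R hR
    -- Two levels `c < d` separate the two means: sums near `R` stay below `n * c`, those at `R₀`
    -- above `n * d`. Strictness of `n * c < n * d` needs `n ≥ 1`.
    obtain ⟨c, hc1, hc⟩ := exists_between (hlt R hR)
    obtain ⟨d, hcd, hd⟩ := exists_between hc
    obtain ⟨δ, hδ, h⟩ := hf.exists_ball_sum_le hZ (θ₀, R) hc1
    have hd' : ∫ ω, -f (θ₀, R₀) (Z 1 ω) ∂P < -d := by
      rw [integral_neg]
      linarith
    obtain ⟨δ', hδ', h'⟩ := hf.neg.exists_ball_sum_le hZ (θ₀, R₀) hd'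
    refine ⟨Metric.ball R δ, mem_nhdsWithin_of_mem_nhds (Metric.ball_mem_nhds R hδ),
      min δ δ', lt_min hδ hδ', ?_⟩
    filter_upwards [h, h'] with ω hω hω'
    filter_upwards [hω, hω', eventually_ge_atTop 1] with n hn hn' hn1 θ hθ R' hR'
    have h1 := hn (θ, R') (by
      rw [← ball_prod_same]
      exact ⟨Metric.ball_subset_ball (min_le_left _ _) hθ, hR'⟩)
    have h2 := hn' (θ, R₀) (by
      rw [← ball_prod_same]
      exact ⟨Metric.ball_subset_ball (min_le_right _ _) hθ, Metric.mem_ball_self hδ'⟩)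
    rw [Finset.sum_neg_distrib] at h2
    have hn0 : (1 : ℝ) ≤ n := by exact_mod_cast hn1
    nlinarith

end Wald

/-! ### Quantile transforms in dimension one -/

section Quantile

/-- The generalized inverse of the distribution function of `ν`, set to `0` outside `(0, 1)`. -/
noncomputable def truncQuantile (ν : Measure ℝ) (u : ℝ) : ℝ :=
  open Classical in if u ∈ Set.Ioo (0 : ℝ) 1 then sInf {y | u ≤ cdf ν y} else 0

/-- The distributional transform `F(y⁻) + v (F(y) - F(y⁻))`. -/
noncomputable def distTransform (ν : Measure ℝ) (q : ℝ × ℝ) : ℝ :=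
  Function.leftLim (cdf ν) q.1 + q.2 * (cdf ν q.1 - Function.leftLim (cdf ν) q.1)

lemma truncQuantile_of_mem {ν : Measure ℝ} {u : ℝ} (hu : u ∈ Set.Ioo (0 : ℝ) 1) :
    truncQuantile ν u = sInf {y | u ≤ cdf ν y} := if_pos hu

/-- For `u` in the open unit interval the set defining the infimum is nonempty and bounded below,
and right continuity of the distribution function makes the infimum attained. -/
lemma truncQuantile_le_iff {ν : Measure ℝ} {u : ℝ} (hu : u ∈ Set.Ioo (0 : ℝ) 1) (y : ℝ) :
    truncQuantile ν u ≤ y ↔ u ≤ cdf ν y := by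
  rw [truncQuantile_of_mem hu]
  obtain ⟨z, hz⟩ := ((tendsto_cdf_atBot ν).eventually_lt_const hu.1).exists
  have hbdd : BddBelow {y | u ≤ cdf ν y} :=
    ⟨z, fun x hx => le_of_not_gt fun h => (hz.trans_le hx).not_ge (monotone_cdf ν h.le)⟩
  obtain ⟨z', hz'⟩ := ((tendsto_cdf_atTop ν).eventually_const_lt hu.2).exists
  have hne : {y | u ≤ cdf ν y}.Nonempty := ⟨z', hz'.le⟩
  refine ⟨fun h => ?_, fun h => csInf_le hbdd h⟩
  refine le_trans ?_ (monotone_cdf ν h)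
  have hright : Tendsto (cdf ν) (𝓝[>] (sInf {y | u ≤ cdf ν y}))
      (𝓝 (cdf ν (sInf {y | u ≤ cdf ν y}))) :=
    ((cdf ν).right_continuous _).mono_left (nhdsWithin_mono _ Set.Ioi_subset_Ici_self)
  refine ge_of_tendsto hright ?_
  filter_upwards [self_mem_nhdsWithin] with x hx
  obtain ⟨x', hx', hlt⟩ := exists_lt_of_csInf_lt hne hx
  exact le_trans hx' (monotone_cdf ν hlt.le)

lemma leftLim_cdf_nonneg (ν : Measure ℝ) (y : ℝ) : 0 ≤ Function.leftLim (cdf ν) y :=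
  (cdf_nonneg ν (y - 1)).trans ((monotone_cdf ν).le_leftLim (by linarith))

lemma leftLim_cdf_le (ν : Measure ℝ) (y : ℝ) : Function.leftLim (cdf ν) y ≤ cdf ν y :=
  (monotone_cdf ν).leftLim_le le_rfl

lemma truncQuantile_eq_of_mem_Ioo {ν : Measure ℝ} {u y : ℝ} (hu : u ∈ Set.Ioo (0 : ℝ) 1)
    (h : u ∈ Set.Ioc (Function.leftLim (cdf ν) y) (cdf ν y)) : truncQuantile ν u = y := by
  refine le_antisymm ((truncQuantile_le_iff hu y).2 h.2) (le_of_not_gt fun hlt => ?_)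
  have h1 := (truncQuantile_le_iff hu (truncQuantile ν u)).1 le_rfl
  exact (h.1.trans_le h1).not_ge ((monotone_cdf ν).le_leftLim hlt)

lemma measurable_truncQuantile_uncurry {α : Type*} [MeasurableSpace α] {ν : α → Measure ℝ}
    (h : ∀ y, Measurable fun a => cdf (ν a) y) :
    Measurable fun p : α × ℝ => truncQuantile (ν p.1) p.2 := by
  refine measurable_of_Iic fun y => ?_
  have hset : (fun p : α × ℝ => truncQuantile (ν p.1) p.2) ⁻¹' Set.Iic y
      = (Prod.snd ⁻¹' Set.Ioo 0 1 ∩ {p : α × ℝ | p.2 ≤ cdf (ν p.1) y})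
        ∪ ((Prod.snd ⁻¹' Set.Ioo 0 1)ᶜ ∩ {_p : α × ℝ | (0 : ℝ) ≤ y}) := by
    ext p
    by_cases hp : p.2 ∈ Set.Ioo (0 : ℝ) 1
    · simp only [Set.mem_preimage, Set.mem_Iic, truncQuantile_le_iff hp, Set.mem_union,
        Set.mem_inter_iff, Set.mem_compl_iff, hp, not_true, true_and, false_and, or_false]
      rfl
    · simp only [Set.mem_preimage, Set.mem_Iic, Set.mem_union, Set.mem_inter_iff,
        Set.mem_compl_iff, hp, not_false_iff, true_and, false_and, false_or, truncQuantile,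
        if_false]
      rfl
  rw [hset]
  have h1 : MeasurableSet (Prod.snd ⁻¹' Set.Ioo 0 1 : Set (α × ℝ)) :=
    measurable_snd measurableSet_Ioo
  exact (h1.inter (measurableSet_le measurable_snd ((h y).comp measurable_fst))).union
    (h1.compl.inter (MeasurableSet.const _))

lemma measurable_truncQuantile (ν : Measure ℝ) : Measurable (truncQuantile ν) :=
  (measurable_truncQuantile_uncurry (α := Unit) (ν := fun _ => ν)
    fun _ => measurable_const).comp (measurable_const.prodMk measurable_id : Measurable
      fun u : ℝ => ((), u))

lemma measurable_leftLim_cdf (ν : Measure ℝ) : Measurable (Function.leftLim (cdf ν)) :=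
  (monotone_cdf ν).leftLim.measurable

lemma measurable_cdf' (ν : Measure ℝ) : Measurable (cdf ν) := (monotone_cdf ν).measurable

lemma measurable_distTransform (ν : Measure ℝ) : Measurable (distTransform ν) :=
  ((measurable_leftLim_cdf ν).comp measurable_fst).add (measurable_snd.mul
    (((measurable_cdf' ν).comp measurable_fst).sub ((measurable_leftLim_cdf ν).comp
      measurable_fst)))

instance : IsProbabilityMeasure (volume.restrict (Set.Icc (0 : ℝ) 1)) :=
  ⟨by simp⟩

lemma ae_mem_Ioo_unit :
    ∀ᵐ u ∂(volume.restrict (Set.Icc (0 : ℝ) 1)), u ∈ Set.Ioo (0 : ℝ) 1 := by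
  rw [Measure.restrict_congr_set Ioo_ae_eq_Icc.symm]
  exact ae_restrict_mem measurableSet_Ioo

variable (ν : Measure ℝ) [IsProbabilityMeasure ν]

lemma map_truncQuantile : (volume.restrict (Set.Icc (0 : ℝ) 1)).map (truncQuantile ν) = ν := by
  have : IsProbabilityMeasure ((volume.restrict (Set.Icc (0 : ℝ) 1)).map (truncQuantile ν)) :=
    Measure.isProbabilityMeasure_map (measurable_truncQuantile ν).aemeasurable
  refine Measure.ext_of_Iic _ _ fun y => ?_
  rw [Measure.map_apply (measurable_truncQuantile ν) measurableSet_Iic, ← ofReal_cdf]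
  have h1 : (volume.restrict (Set.Icc (0 : ℝ) 1)) (truncQuantile ν ⁻¹' Set.Iic y)
      = (volume.restrict (Set.Icc (0 : ℝ) 1)) (Set.Iic (cdf ν y)) := by
    refine measure_congr ?_
    filter_upwards [ae_mem_Ioo_unit] with u hu
    exact propext (truncQuantile_le_iff hu y)
  rw [h1, Measure.restrict_apply measurableSet_Iic]
  have h2 : Set.Iic (cdf ν y) ∩ Set.Icc (0 : ℝ) 1 = Set.Icc 0 (cdf ν y) := by
    ext u
    have := cdf_le_one ν y
    simp only [Set.mem_inter_iff, Set.mem_Iic, Set.mem_Icc]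
    constructor
    · rintro ⟨h, h', -⟩
      exact ⟨h', h⟩
    · rintro ⟨h, h'⟩
      exact ⟨h', h, h'.trans this⟩
  rw [h2, Real.volume_Icc, sub_zero]

lemma measure_singleton_eq_cdf (y : ℝ) :
    ν {y} = ENNReal.ofReal (cdf ν y - Function.leftLim (cdf ν) y) := by
  conv_lhs => rw [← measure_cdf ν]
  rw [StieltjesFunction.measure_singleton]

lemma measure_Iio_eq_leftLim_cdf (y : ℝ) :
    ν (Set.Iio y) = ENNReal.ofReal (Function.leftLim (cdf ν) y) := by
  conv_lhs => rw [← measure_cdf ν]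
  rw [StieltjesFunction.measure_Iio _ (tendsto_cdf_atBot ν), sub_zero]

lemma leftLim_cdf_eq_real (y : ℝ) : Function.leftLim (cdf ν) y = ν.real (Set.Iio y) := by
  rw [measureReal_def, measure_Iio_eq_leftLim_cdf, ENNReal.toReal_ofReal (leftLim_cdf_nonneg ν y)]

variable {ν}

lemma leftLim_cdf_eq {y : ℝ} (h : ν {y} = 0) : Function.leftLim (cdf ν) y = cdf ν y := by
  rw [measure_singleton_eq_cdf, ENNReal.ofReal_eq_zero] at h
  exact le_antisymm (leftLim_cdf_le ν y) (by linarith)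

/-- Strictly below the quantile the distribution function is less than `u`, so its left limit there
is at most `u`; without an atom the left limit is the value. -/
lemma cdf_truncQuantile {u : ℝ} (hu : u ∈ Set.Ioo (0 : ℝ) 1) (h : ν {truncQuantile ν u} = 0) :
    cdf ν (truncQuantile ν u) = u := by
  refine le_antisymm ?_ ((truncQuantile_le_iff hu _).1 le_rfl)
  rw [← leftLim_cdf_eq h]
  refine le_of_tendsto ((monotone_cdf ν).tendsto_leftLim _) ?_
  filter_upwards [self_mem_nhdsWithin] with x hx
  by_contra hlt
  exact not_lt_of_ge ((truncQuantile_le_iff hu x).2 (not_le.1 hlt).le) hx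

/-- Joint law of `(F⁻¹(u), u)` for `u` uniform, when `F` is continuous. -/
lemma map_prod_distTransform_of_continuous (h : ∀ y, ν {y} = 0) :
    (ν.prod (volume.restrict (Set.Icc (0 : ℝ) 1))).map (fun q => (q.1, distTransform ν q))
      = (volume.restrict (Set.Icc (0 : ℝ) 1)).map fun u => (truncQuantile ν u, u) := by
  have h1 : (fun q : ℝ × ℝ => (q.1, distTransform ν q))
      = (fun y => (y, cdf ν y)) ∘ Prod.fst := by
    funext q
    simp [distTransform, leftLim_cdf_eq (h q.1)]
  have hm : Measurable fun y => (y, cdf ν y) := measurable_id.prodMk (measurable_cdf' ν)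
  rw [h1, ← Measure.map_map hm measurable_fst, Measure.map_fst_prod, measure_univ, one_smul]
  have h2 : ν.map (fun y => (y, cdf ν y)) = (volume.restrict (Set.Icc (0 : ℝ) 1)).map
      ((fun y => (y, cdf ν y)) ∘ truncQuantile ν) := by
    rw [← Measure.map_map hm (measurable_truncQuantile ν), map_truncQuantile ν]
  rw [h2]
  refine Measure.map_congr ?_
  filter_upwards [ae_mem_Ioo_unit] with u hu
  simp [cdf_truncQuantile hu (h _)]

/-- The affine map `v ↦ a + v (b - a)` carries the uniform law on `[0,1]` to the uniform law on the
interval. When `a = b` both sides are zero. -/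
lemma volume_restrict_Ioc_eq {a b : ℝ} (hab : a ≤ b) :
    volume.restrict (Set.Ioc a b) = ENNReal.ofReal (b - a) •
      (volume.restrict (Set.Icc (0 : ℝ) 1)).map fun v => a + v * (b - a) := by
  rcases hab.eq_or_lt with rfl | hlt
  · simp
  have hpos : 0 < b - a := sub_pos.2 hlt
  have hm : Measurable fun v : ℝ => a + v * (b - a) := by fun_prop
  ext s hs
  have hcomp : (volume : Measure ℝ).map (fun v => a + v * (b - a))
      = ENNReal.ofReal |(b - a)⁻¹| • volume := by
    have : (fun v : ℝ => a + v * (b - a)) = (fun v => a + v) ∘ (fun v => v * (b - a)) := rfl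
    rw [this, ← Measure.map_map (by fun_prop) (by fun_prop), Real.map_volume_mul_right hpos.ne',
      Measure.map_smul, (measurePreserving_add_left volume a).map_eq]
  rw [Measure.smul_apply, Measure.map_apply hm hs, Measure.restrict_apply hs,
    Measure.restrict_apply (hm hs)]
  have hpre : (fun v : ℝ => a + v * (b - a)) ⁻¹' s ∩ Set.Icc 0 1
      = (fun v : ℝ => a + v * (b - a)) ⁻¹' (s ∩ Set.Icc a b) := by
    ext v
    simp only [Set.mem_inter_iff, Set.mem_preimage, Set.mem_Icc]
    refine and_congr_right fun _ => ⟨fun ⟨h1, h2⟩ => ⟨?_, ?_⟩, fun ⟨h1, h2⟩ => ⟨?_, ?_⟩⟩ <;>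
      nlinarith
  rw [hpre, ← Measure.map_apply hm (hs.inter measurableSet_Icc), hcomp, Measure.smul_apply,
    smul_eq_mul, smul_eq_mul, ← mul_assoc, ← ENNReal.ofReal_mul hpos.le, abs_of_pos (inv_pos.2 hpos),
    mul_inv_cancel₀ hpos.ne', ENNReal.ofReal_one, one_mul, ← Measure.restrict_apply hs,
    ← Measure.restrict_apply hs, Measure.restrict_congr_set Ioc_ae_eq_Icc]

/-- Joint law of `(F⁻¹(u), u)` for `u` uniform, when `F` is purely discrete. -/
lemma map_prod_distTransform_of_discrete {ι : Type*} [Countable ι] {a : ι → ℝ}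
    (ha : Function.Injective a) (hν : ν = Measure.sum fun j => ν {a j} • Measure.dirac (a j)) :
    (ν.prod (volume.restrict (Set.Icc (0 : ℝ) 1))).map (fun q => (q.1, distTransform ν q))
      = (volume.restrict (Set.Icc (0 : ℝ) 1)).map fun u => (truncQuantile ν u, u) := by
  set L := volume.restrict (Set.Icc (0 : ℝ) 1) with hL
  set I : ι → Set ℝ := fun j => Set.Ioc (Function.leftLim (cdf ν) (a j)) (cdf ν (a j)) with hI
  have hIm : ∀ j, MeasurableSet (I j) := fun j => measurableSet_Ioc
  have hIsub : ∀ j, I j ⊆ Set.Icc 0 1 := fun j u hu =>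
    ⟨(leftLim_cdf_nonneg ν _).trans hu.1.le, hu.2.trans (cdf_le_one ν _)⟩
  have hdisj : Pairwise (Function.onFun Disjoint I) := by
    intro i j hij
    refine Set.disjoint_left.2 fun u hui huj => ?_
    rcases lt_or_gt_of_ne (ha.ne hij) with h | h
    · exact (huj.1.trans_le hui.2).not_ge ((monotone_cdf ν).le_leftLim h)
    · exact (hui.1.trans_le huj.2).not_ge ((monotone_cdf ν).le_leftLim h)
  have hvol : ∀ j, volume (I j) = ν {a j} := fun j => by
    rw [Real.volume_Ioc, measure_singleton_eq_cdf]
  -- The disjoint jump intervals have lengths equal to the masses of the atoms, which sum to `1`.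
  -- They therefore cover `[0,1]` up to a null set.
  have htot : volume (⋃ j, I j) = 1 := by
    rw [measure_iUnion hdisj hIm]
    have h1 := congrArg (fun m => m Set.univ) hν
    simp only [measure_univ, Measure.sum_apply _ MeasurableSet.univ, Measure.smul_apply,
      smul_eq_mul, mul_one] at h1
    simp_rw [hvol]
    exact h1.symm
  have hLsum : L = Measure.sum fun j => volume.restrict (I j) := by
    rw [← Measure.restrict_iUnion hdisj hIm, hL]
    refine (Measure.restrict_congr_set (ae_eq_of_subset_of_measure_ge
      (Set.iUnion_subset hIsub) ?_ (MeasurableSet.iUnion hIm).nullMeasurableSet (by simp))).symm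
    rw [htot]
    simp
  have hmT : Measurable fun q : ℝ × ℝ => (q.1, distTransform ν q) :=
    measurable_fst.prodMk (measurable_distTransform ν)
  have hmQ : Measurable fun u => (truncQuantile ν u, u) :=
    (measurable_truncQuantile ν).prodMk measurable_id
  -- On the jump interval at `a j` the quantile is constant, equal to `a j`; conversely, given that
  -- atom, the transform is uniform on the interval.
  have hterm : ∀ j, ((ν {a j} • Measure.dirac (a j)).prod L).map
      (fun q : ℝ × ℝ => (q.1, distTransform ν q))
        = (volume.restrict (I j)).map fun u => (truncQuantile ν u, u) := by
    intro j
    have hcongr : (volume.restrict (I j)).map (fun u => (truncQuantile ν u, u))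
        = (volume.restrict (I j)).map fun u => (a j, u) := by
      refine Measure.map_congr ?_
      have h1 : ∀ᵐ u ∂(volume.restrict (I j)), u ∈ Set.Ioo (0 : ℝ) 1 :=
        ae_restrict_of_ae_restrict_of_subset (hIsub j) ae_mem_Ioo_unit
      filter_upwards [h1, ae_restrict_mem (hIm j)] with u hu hu'
      rw [truncQuantile_eq_of_mem_Ioo hu hu']
    have hmj : Measurable fun u : ℝ => (a j, u) := measurable_const.prodMk measurable_id
    have hma : Measurable fun v : ℝ => Function.leftLim (cdf ν) (a j)
        + v * (cdf ν (a j) - Function.leftLim (cdf ν) (a j)) := by fun_prop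
    rw [hcongr, volume_restrict_Ioc_eq (leftLim_cdf_le ν (a j)), ← measure_singleton_eq_cdf,
      Measure.prod_smul_left, Measure.map_smul, Measure.map_smul, Measure.dirac_prod,
      Measure.map_map hmT hmj, Measure.map_map hmj hma]
    rfl
  have hprod : ν.prod L = Measure.sum fun j => (ν {a j} • Measure.dirac (a j)).prod L := by
    conv_lhs => rw [hν]
    rw [Measure.prod_sum_left]
  rw [hprod, Measure.map_sum hmT.aemeasurable]
  simp_rw [hterm]
  rw [← Measure.map_sum (hLsum ▸ hmQ.aemeasurable), ← hLsum]

end Quantile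

/-! ### Product measures -/

section Pi

/-- Tonelli's theorem for a product of functions of one variable. -/
lemma lintegral_fin_prod_eq_prod {n : ℕ} {E : Fin n → Type*} {mE : ∀ i, MeasurableSpace (E i)}
    {μ : (i : Fin n) → Measure (E i)} [∀ i, SigmaFinite (μ i)]
    {f : (i : Fin n) → E i → ℝ≥0∞} (hf : ∀ i, Measurable (f i)) :
    ∫⁻ x : (i : Fin n) → E i, ∏ i, f i (x i) ∂(Measure.pi μ) = ∏ i, ∫⁻ x, f i x ∂(μ i) := by
  induction n with
  | zero => simp
  | succ n ih =>
    have hm : Measurable fun x : (i : Fin n) → E i.succ => ∏ i, f i.succ (x i) :=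
      Finset.measurable_prod _ fun i _ => (hf _).comp (measurable_pi_apply i)
    calc
      _ = ∫⁻ x : E 0 × ((i : Fin n) → E i.succ), f 0 x.1 * ∏ i : Fin n, f i.succ (x.2 i)
            ∂((μ 0).prod (Measure.pi fun i => μ i.succ)) := by
          have h := (measurePreserving_piFinSuccAbove μ 0).lintegral_comp
            (f := fun x : E 0 × ((i : Fin n) → E i.succ) =>
              f 0 x.1 * ∏ i : Fin n, f i.succ (x.2 i))
            (((hf 0).comp measurable_fst).mul (hm.comp measurable_snd))
          refine Eq.trans (lintegral_congr fun x => ?_) h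
          rw [Fin.prod_univ_succ]
          rfl
      _ = ∏ i, ∫⁻ x, f i x ∂(μ i) := by
          rw [lintegral_prod_mul (hf 0).aemeasurable hm.aemeasurable, ih fun i => hf _,
            Fin.prod_univ_succ]

lemma pi_withDensity {n : ℕ} {μ : Fin n → Measure ℝ} [∀ i, SigmaFinite (μ i)]
    {f : Fin n → ℝ → ℝ≥0∞} (hf : ∀ i, Measurable (f i))
    [∀ i, SigmaFinite ((μ i).withDensity (f i))] :
    Measure.pi (fun i => (μ i).withDensity (f i))
      = (Measure.pi μ).withDensity fun x => ∏ i, f i (x i) := by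
  refine Measure.pi_eq fun s hs => ?_
  rw [withDensity_apply _ (MeasurableSet.univ_pi hs), Measure.restrict_pi_pi,
    lintegral_fin_prod_eq_prod hf]
  exact Finset.prod_congr rfl fun i _ => (withDensity_apply _ (hs i)).symm

lemma pi_smul {ι : Type*} [Fintype ι] {μ ν : ι → Measure ℝ} [∀ i, SigmaFinite (μ i)]
    [∀ i, SigmaFinite (ν i)] {r : ι → ℝ≥0∞} (h : ∀ i, ν i = r i • μ i) :
    Measure.pi ν = (∏ i, r i) • Measure.pi μ := by
  refine Measure.pi_eq fun s hs => ?_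
  simp [h, Measure.pi_pi, Finset.prod_mul_distrib]

/-- Integrating out coordinates against Dirac masses is evaluation. -/
lemma lmarginal_dirac {ι : Type*} [DecidableEq ι] {μ : ι → Measure ℝ} {t : Finset ι} {z : ι → ℝ}
    (hμ : ∀ i ∈ t, μ i = Measure.dirac (z i)) (f : (ι → ℝ) → ℝ≥0∞) :
    lmarginal μ t f z = f z := by
  have h1 : (fun i : t => μ i) = fun i : t => Measure.dirac (z i) := funext fun i => hμ i i.2
  have h2 : Measure.pi (fun i : t => Measure.dirac (z i)) = Measure.dirac fun i : t => z i := by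
    refine Measure.pi_eq fun s hs => ?_
    rw [Measure.dirac_apply' _ (MeasurableSet.univ_pi hs)]
    simp_rw [Measure.dirac_apply' _ (hs _)]
    by_cases h : (fun i : t => z i) ∈ Set.univ.pi s
    · rw [Set.indicator_of_mem h]
      refine (Finset.prod_eq_one fun i _ => ?_).symm
      rw [Set.indicator_of_mem (h i trivial)]
      rfl
    · rw [Set.indicator_of_notMem h]
      simp only [Set.mem_univ_pi, not_forall] at h
      obtain ⟨i, hi⟩ := h
      exact (Finset.prod_eq_zero (Finset.mem_univ i) (Set.indicator_of_notMem hi _)).symm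
  rw [lmarginal, h1, h2, lintegral_dirac]
  congr 1
  funext i
  simp [Function.updateFinset]

end Pi

/-! ### The reference measures -/

/-- Binary and count components are treated together as counting measures on sets of integers. -/
lemma Kind.exists_refMeasure_eq_sum {κ : Kind} (h : κ.isDiscrete = true) :
    ∃ s : Set ℕ, κ.refMeasure = Measure.sum fun j : s => Measure.dirac ((j : ℕ) : ℝ) := by
  cases κ with
  | continuous => cases h
  | binary =>
    refine ⟨{0, 1}, ?_⟩
    ext A hA
    rw [Measure.sum_apply _ hA]
    have h2 := tsum_subtype ({0, 1} : Set ℕ) (fun n : ℕ => Measure.dirac (n : ℝ) A)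
    refine Eq.trans ?_ h2.symm
    rw [tsum_eq_sum (s := {0, 1}) (fun b hb => by
      refine Set.indicator_of_notMem ?_ _
      simpa using hb)]
    simp [Kind.refMeasure]
  | count =>
    refine ⟨Set.univ, ?_⟩
    ext A hA
    rw [Measure.sum_apply _ hA]
    exact (Measure.sum_apply _ hA).trans
      (tsum_univ (fun n : ℕ => Measure.dirac (n : ℝ) A)).symm

instance (κ : Kind) : SigmaFinite κ.refMeasure := by
  cases κ with
  | continuous => exact inferInstanceAs (SigmaFinite (volume : Measure ℝ))
  | binary => exact inferInstanceAs (SigmaFinite (Measure.dirac 0 + Measure.dirac 1))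
  | count =>
    have hr : MeasurableSet (Set.range (Nat.cast : ℕ → ℝ))ᶜ :=
      (Set.countable_range _).measurableSet.compl
    refine Measure.sigmaFinite_of_countable
      -- The countable cover consists of the singletons, of mass one, and the complement of `ℕ`, of
      -- mass zero.
      (S := insert (Set.range (Nat.cast : ℕ → ℝ))ᶜ (Set.range fun n : ℕ => {(n : ℝ)}))
      ((Set.countable_range _).insert _) ?_ ?_
    · rintro s (rfl | ⟨n, rfl⟩)
      · simp [Kind.refMeasure, Measure.sum_apply _ hr]
      · rw [Kind.refMeasure, Measure.sum_apply _ (measurableSet_singleton _), tsum_eq_single n]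
        · simp
        · intro m hm
          simp [hm]
    · refine Set.eq_univ_of_forall fun x => ?_
      by_cases hx : x ∈ Set.range (Nat.cast : ℕ → ℝ)
      · obtain ⟨n, rfl⟩ := hx
        exact ⟨_, Or.inr ⟨n, rfl⟩, rfl⟩
      · exact ⟨_, Or.inl rfl, hx⟩

/-! ### Marginal laws and the conditional density as an average over the distributional transform -/

namespace Model

variable {k m Q S : ℕ} (M : Model k m Q S)

instance : SigmaFinite M.refMeasure := by unfold refMeasure; infer_instance

lemma measurable_dens_right (i : Fin k) (s : ℝ) : Measurable (M.dens i s) :=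
  (M.measurable_dens i).comp measurable_prodMk_left

variable {M}

lemma isProbabilityMeasure_marginal {i : Fin k} {s : ℝ} (hs : s ∈ M.G i) :
    IsProbabilityMeasure (M.marginal i s) :=
  ⟨by rw [marginal, withDensity_apply _ MeasurableSet.univ, Measure.restrict_univ,
    M.lintegral_dens i s hs]⟩

lemma marginal_singleton_of_continuous {i : Fin k} (h : (M.kind i).isDiscrete = false) (s y : ℝ) :
    M.marginal i s {y} = 0 := by
  have hk : M.kind i = .continuous := by
    cases hk : M.kind i <;> simp [hk, Kind.isDiscrete] at h ⊢
  rw [marginal, hk]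
  exact withDensity_absolutelyContinuous _ _ Real.volume_singleton

lemma exists_marginal_eq_sum {i : Fin k} (h : (M.kind i).isDiscrete = true) (s : ℝ) :
    ∃ t : Set ℕ, (M.kind i).refMeasure = Measure.sum (fun j : t => Measure.dirac ((j : ℕ) : ℝ)) ∧
      (∀ j : t, M.marginal i s {((j : ℕ) : ℝ)} = M.dens i s ((j : ℕ) : ℝ)) ∧
      M.marginal i s = Measure.sum fun j : t =>
        M.marginal i s {((j : ℕ) : ℝ)} • Measure.dirac ((j : ℕ) : ℝ) := by
  obtain ⟨t, ht⟩ := Kind.exists_refMeasure_eq_sum h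
  have h1 : ∀ j : t, M.marginal i s {((j : ℕ) : ℝ)} = M.dens i s ((j : ℕ) : ℝ) := by
    intro j
    rw [marginal, withDensity_apply _ (measurableSet_singleton _), lintegral_singleton, ht,
      Measure.sum_apply _ (measurableSet_singleton _), tsum_eq_single j]
    · simp
    · intro j' hj'
      simp only [measurableSet_singleton, Measure.dirac_apply', Set.indicator_apply_eq_zero,
        Set.mem_singleton_iff, Nat.cast_inj]
      exact fun h => absurd (Subtype.ext h) hj'
  refine ⟨t, ht, h1, ?_⟩
  simp_rw [h1]
  rw [marginal, ht, withDensity_sum]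
  exact congrArg _ (funext fun j => dirac_withDensity _ _)

lemma map_prod_distTransform {i : Fin k} {s : ℝ} (hs : s ∈ M.G i) :
    ((M.marginal i s).prod (volume.restrict (Set.Icc (0 : ℝ) 1))).map
        (fun q => (q.1, distTransform (M.marginal i s) q))
      = (volume.restrict (Set.Icc (0 : ℝ) 1)).map
        fun u => (truncQuantile (M.marginal i s) u, u) := by
  have := isProbabilityMeasure_marginal hs
  cases h : (M.kind i).isDiscrete with
  | false => exact map_prod_distTransform_of_continuous (marginal_singleton_of_continuous h s)
  | true =>
    obtain ⟨t, -, -, h1⟩ := exists_marginal_eq_sum h s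
    exact map_prod_distTransform_of_discrete
      (Nat.cast_injective.comp Subtype.val_injective) h1

/-- The conditional law of one coordinate of the copula given the observation. -/
noncomputable def fiber (M : Model k m Q S) (i : Fin k) (s y : ℝ) : Measure ℝ :=
  (volume.restrict (Set.Icc (0 : ℝ) 1)).map fun v => distTransform (M.marginal i s) (y, v)

lemma measurable_distTransform_right (ν : Measure ℝ) (y : ℝ) :
    Measurable fun v => distTransform ν (y, v) :=
  (measurable_distTransform ν).comp measurable_prodMk_left

instance (i : Fin k) (s y : ℝ) : IsProbabilityMeasure (M.fiber i s y) :=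
  Measure.isProbabilityMeasure_map (measurable_distTransform_right _ _).aemeasurable

lemma fiber_of_continuous {i : Fin k} (h : (M.kind i).isDiscrete = false) {s : ℝ}
    (hs : s ∈ M.G i) (y : ℝ) : M.fiber i s y = Measure.dirac (M.margCdf i s y) := by
  have := isProbabilityMeasure_marginal hs
  have h1 := leftLim_cdf_eq (marginal_singleton_of_continuous h s y)
  rw [fiber]
  simp [distTransform, h1, margCdf]

lemma restrict_Ioc_eq_smul_fiber (i : Fin k) (s y : ℝ) :
    volume.restrict (Set.Ioc (M.margCdfLeft i s y) (M.margCdf i s y))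
      = ENNReal.ofReal (M.margCdf i s y - M.margCdfLeft i s y) • M.fiber i s y :=
  volume_restrict_Ioc_eq (leftLim_cdf_le _ _)

/-- At a support point of the counting measure, the density is the mass of an atom, that is, a jump
of the distribution function. Elsewhere the density is arbitrary, hence the almost everywhere
statement. -/
lemma ae_dens_eq {i : Fin k} (h : (M.kind i).isDiscrete = true) {s : ℝ} (hs : s ∈ M.G i) :
    ∀ᵐ y ∂(M.kind i).refMeasure,
      M.dens i s y = ENNReal.ofReal (M.margCdf i s y - M.margCdfLeft i s y) := by
  have := isProbabilityMeasure_marginal hs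
  obtain ⟨t, h1, h2, -⟩ := exists_marginal_eq_sum h s
  rw [h1, Measure.ae_sum_iff]
  intro j
  have hd : M.dens i s ((j : ℕ) : ℝ) = ENNReal.ofReal
      (M.margCdf i s ((j : ℕ) : ℝ) - M.margCdfLeft i s ((j : ℕ) : ℝ)) := by
    rw [← h2, measure_singleton_eq_cdf]
    rfl
  rw [ae_dirac_eq]
  exact hd

/-- Given `y_i`, the transform has law `fiber`. For a discrete coordinate, Lebesgue measure on the
jump interval is the density times `fiber`; for a continuous one, `fiber` is a Dirac mass and
integration is evaluation. Both kinds of coordinates thus take the same form. -/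
lemma condDensity_eq {R : EuclideanSpace ℝ (Fin S)} (hR : R ∈ M.Γ) {s : Fin k → ℝ}
    (hs : s ∈ M.latentSpace) :
    ∀ᵐ y ∂M.refMeasure, M.condDensity R s y = (∏ i, M.dens i (s i) (y i)) *
      ∫⁻ v, M.copula R (fun i => distTransform (M.marginal i (s i)) (y i, v i))
        ∂(Measure.pi fun _ => volume.restrict (Set.Icc (0 : ℝ) 1)) := by
  classical
  have hc := (M.isCopulaDensity R hR).measurable
  have hae : ∀ᵐ y ∂M.refMeasure, ∀ i, (M.kind i).isDiscrete = true →
      M.dens i (s i) (y i)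
        = ENNReal.ofReal (M.margCdf i (s i) (y i) - M.margCdfLeft i (s i) (y i)) := by
    rw [ae_all_iff]
    intro i
    cases h : (M.kind i).isDiscrete with
    | false => simp
    | true =>
      have := Measure.tendsto_eval_ae_ae (μ := fun i => (M.kind i).refMeasure) (i := i)
        |>.eventually (ae_dens_eq h (hs i trivial))
      filter_upwards [this] with y hy _
      exact hy
  filter_upwards [hae] with y hy
  set z : Fin k → ℝ := fun i => M.margCdf i (s i) (y i) with hz
  set D := Finset.univ.filter fun i => (M.kind i).isDiscrete = true with hD
  set D' := Finset.univ.filter fun i => (M.kind i).isDiscrete = false with hD'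
  set κ : Fin k → Measure ℝ := fun i => M.fiber i (s i) (y i) with hκ
  have hunion : D ∪ D' = Finset.univ := by
    ext i
    cases h : (M.kind i).isDiscrete <;> simp [hD, hD', h]
  have hdisj : Disjoint D D' := by
    rw [Finset.disjoint_left]
    intro i hi hi'
    simp only [hD, hD', Finset.mem_filter, Finset.mem_univ, true_and] at hi hi'
    simp [hi] at hi'
  have h1 : ∫⁻ v, M.copula R (fun i => distTransform (M.marginal i (s i)) (y i, v i))
        ∂(Measure.pi fun _ => volume.restrict (Set.Icc (0 : ℝ) 1)) = lmarginal κ D (M.copula R) z := by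
    have hmeas : ∀ i, Measurable fun v => distTransform (M.marginal i (s i)) (y i, v) :=
      fun i => measurable_distTransform_right _ _
    have hpi := Measure.pi_map_pi (μ := fun _ : Fin k => volume.restrict (Set.Icc (0 : ℝ) 1))
      (f := fun i v => distTransform (M.marginal i (s i)) (y i, v))
      (hμ := fun i => inferInstanceAs (SigmaFinite (M.fiber i (s i) (y i))))
      fun i => (hmeas i).aemeasurable
    have hpim : Measurable fun (v : Fin k → ℝ) i =>
        distTransform (M.marginal i (s i)) (y i, v i) :=
      measurable_pi_lambda _ fun i => (hmeas i).comp (measurable_pi_apply i)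
    calc _ = ∫⁻ u, M.copula R u ∂(Measure.pi κ) := by
          rw [hκ]
          refine Eq.trans ?_ (congrArg (fun μ => ∫⁻ u, M.copula R u ∂μ) hpi)
          rw [lintegral_map hc hpim]
      _ = lmarginal κ (D ∪ D') (M.copula R) z := by
          rw [hunion, ← lintegral_eq_lmarginal_univ]
      _ = lmarginal κ D' (lmarginal κ D (M.copula R)) z := by
          rw [lmarginal_union' _ _ hc hdisj]
      _ = _ := by
          refine lmarginal_dirac (fun i hi => ?_) _
          exact fiber_of_continuous (by simpa [hD'] using hi) (hs i trivial) _
  have h2 : lmarginal (fun i => volume.restrict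
        (Set.Ioc (M.margCdfLeft i (s i) (y i)) (M.margCdf i (s i) (y i)))) D (M.copula R) z
      = (∏ i ∈ D, M.dens i (s i) (y i)) * lmarginal κ D (M.copula R) z := by
    rw [lmarginal, pi_smul (fun i : D => restrict_Ioc_eq_smul_fiber (M := M) (i : Fin k) (s i) (y i)),
      lintegral_smul_measure, smul_eq_mul, lmarginal]
    congr 1
    rw [← Finset.prod_coe_sort D]
    refine Finset.prod_congr rfl fun i _ => (hy i ?_).symm
    exact (Finset.mem_filter.1 i.2).2
  have hprod : (∏ i, M.dens i (s i) (y i))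
      = (∏ i ∈ D', M.dens i (s i) (y i)) * ∏ i ∈ D, M.dens i (s i) (y i) := by
    rw [← hunion, Finset.prod_union hdisj, mul_comm]
  rw [h1, hprod, mul_assoc, ← h2, condDensity]

end Model

lemma copulaMeasure_eq {k : ℕ} (c : (Fin k → ℝ) → ℝ≥0∞) :
    copulaMeasure c
      = (Measure.pi fun _ : Fin k => volume.restrict (Set.Icc (0 : ℝ) 1)).withDensity c := by
  rw [copulaMeasure, volume_pi, Measure.restrict_pi_pi]

lemma ae_copulaMeasure_mem_Ioo {k : ℕ} (c : (Fin k → ℝ) → ℝ≥0∞) :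
    ∀ᵐ u ∂(copulaMeasure c), ∀ i, u i ∈ Set.Ioo (0 : ℝ) 1 := by
  rw [copulaMeasure_eq]
  refine (withDensity_absolutelyContinuous _ _).ae_le (ae_all_iff.2 fun i => ?_)
  exact (Measure.tendsto_eval_ae_ae (i := i)).eventually ae_mem_Ioo_unit

namespace Model

variable {k m Q S : ℕ} {M : Model k m Q S}

/-! ### Measurability in the latent variable and the observation -/

section Measurability

variable {α : Type*} [MeasurableSpace α]

/-- Distribution functions and their left limits are masses of sections `{x ≤ y}` and `{x < y}`, so
their joint measurability reduces to this case. -/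
lemma measurable_lintegral_dens {i : Fin k} {σ : α → ℝ} (hσ : Measurable σ) {A : Set (α × ℝ)}
    (hA : MeasurableSet A) : Measurable fun a => M.marginal i (σ a) (Prod.mk a ⁻¹' A) := by
  have h1 : (fun a => M.marginal i (σ a) (Prod.mk a ⁻¹' A)) = fun a =>
      ∫⁻ x, A.indicator (fun p : α × ℝ => M.dens i (σ p.1) p.2) (a, x)
        ∂(M.kind i).refMeasure := by
    funext a
    rw [marginal, withDensity_apply _ (measurable_prodMk_left hA),
      ← lintegral_indicator (measurable_prodMk_left hA)]
    rfl
  rw [h1]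
  refine Measurable.lintegral_prod_right' (Measurable.indicator ?_ hA)
  exact (M.measurable_dens i).comp ((hσ.comp measurable_fst).prodMk measurable_snd)

variable {σ y : α → (Fin k → ℝ)}

lemma measurable_margCdf (hσ : Measurable σ) (hσG : ∀ a, σ a ∈ M.latentSpace) (hy : Measurable y)
    (i : Fin k) : Measurable fun a => M.margCdf i (σ a i) (y a i) := by
  have h1 : (fun a => M.margCdf i (σ a i) (y a i)) = fun a =>
      (M.marginal i (σ a i) (Prod.mk a ⁻¹' {p : α × ℝ | p.2 ≤ y p.1 i})).toReal := by
    funext a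
    have := isProbabilityMeasure_marginal (hσG a i trivial)
    rw [margCdf, cdf_eq_real]
    rfl
  rw [h1]
  refine (measurable_lintegral_dens ((measurable_pi_apply i).comp hσ) ?_).ennreal_toReal
  exact measurableSet_le measurable_snd (((measurable_pi_apply i).comp hy).comp measurable_fst)

lemma measurable_margCdfLeft (hσ : Measurable σ) (hσG : ∀ a, σ a ∈ M.latentSpace)
    (hy : Measurable y) (i : Fin k) : Measurable fun a => M.margCdfLeft i (σ a i) (y a i) := by
  have h1 : (fun a => M.margCdfLeft i (σ a i) (y a i)) = fun a =>
      (M.marginal i (σ a i) (Prod.mk a ⁻¹' {p : α × ℝ | p.2 < y p.1 i})).toReal := by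
    funext a
    have := isProbabilityMeasure_marginal (hσG a i trivial)
    rw [margCdfLeft, leftLim_cdf_eq_real]
    rfl
  rw [h1]
  refine (measurable_lintegral_dens ((measurable_pi_apply i).comp hσ) ?_).ennreal_toReal
  exact measurableSet_lt measurable_snd (((measurable_pi_apply i).comp hy).comp measurable_fst)

lemma measurable_condDensity {R : EuclideanSpace ℝ (Fin S)} (hR : R ∈ M.Γ) (hσ : Measurable σ)
    (hσG : ∀ a, σ a ∈ M.latentSpace) (hy : Measurable y) :
    Measurable fun a => M.condDensity R (σ a) (y a) := by
  have hc := (M.isCopulaDensity R hR).measurable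
  have hF := measurable_margCdf hσ hσG hy
  have hF' := measurable_margCdfLeft hσ hσG hy
  refine Measurable.mul (Finset.measurable_prod _ fun i _ => (M.measurable_dens i).comp
    (((measurable_pi_apply i).comp hσ).prodMk ((measurable_pi_apply i).comp hy))) ?_
  set D := Finset.univ.filter fun i => (M.kind i).isDiscrete = true
  -- The domain of integration varies with `a`; an indicator on the product space turns this into a
  -- parametrized integral against a fixed measure.
  set A : Set (α × (D → ℝ)) := {p | ∀ i : D, p.2 i ∈ Set.Ioc
    (M.margCdfLeft i (σ p.1 i) (y p.1 i)) (M.margCdf i (σ p.1 i) (y p.1 i))} with hAdef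
  have hA : MeasurableSet A := by
    rw [hAdef, Set.ext (show ∀ p, p ∈ {p : α × (D → ℝ) | ∀ i : D, p.2 i ∈ Set.Ioc
      (M.margCdfLeft i (σ p.1 i) (y p.1 i)) (M.margCdf i (σ p.1 i) (y p.1 i))} ↔
      p ∈ ⋂ i : D, ({p : α × (D → ℝ) | M.margCdfLeft i (σ p.1 i) (y p.1 i) < p.2 i} ∩
        {p : α × (D → ℝ) | p.2 i ≤ M.margCdf i (σ p.1 i) (y p.1 i)}) by
        intro p; simp only [Set.mem_iInter]; rfl)]
    refine MeasurableSet.iInter fun i => MeasurableSet.inter ?_ ?_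
    · exact measurableSet_lt ((hF' i).comp measurable_fst)
        ((measurable_pi_apply i).comp measurable_snd)
    · exact measurableSet_le ((measurable_pi_apply i).comp measurable_snd)
        ((hF i).comp measurable_fst)
  have hup : Measurable fun p : α × (D → ℝ) => Function.updateFinset
      (fun i => M.margCdf i (σ p.1 i) (y p.1 i)) D p.2 := by
    refine measurable_pi_lambda _ fun i => ?_
    by_cases hi : i ∈ D
    · simp only [Function.updateFinset, hi, dif_pos]
      exact (measurable_pi_apply _).comp measurable_snd
    · simp only [Function.updateFinset, hi, dif_neg, not_false_iff]
      exact (hF i).comp measurable_fst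
  have h1 : (fun a => lmarginal (fun i => volume.restrict (Set.Ioc
      (M.margCdfLeft i (σ a i) (y a i)) (M.margCdf i (σ a i) (y a i)))) D (M.copula R)
      (fun i => M.margCdf i (σ a i) (y a i))) = fun a => ∫⁻ v : D → ℝ, A.indicator
        (fun p => M.copula R (Function.updateFinset
          (fun i => M.margCdf i (σ p.1 i) (y p.1 i)) D p.2)) (a, v) := by
    funext a
    rw [lmarginal, ← Measure.restrict_pi_pi (fun _ : D => (volume : Measure ℝ)),
      ← lintegral_indicator (MeasurableSet.univ_pi fun i => measurableSet_Ioc), ← volume_pi]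
    refine lintegral_congr fun v => ?_
    by_cases hv : (a, v) ∈ A
    · have hv' : v ∈ Set.univ.pi fun i : D => Set.Ioc
          (M.margCdfLeft i (σ a i) (y a i)) (M.margCdf i (σ a i) (y a i)) := fun i _ => hv i
      rw [Set.indicator_of_mem hv, Set.indicator_of_mem hv']
    · have hv' : v ∉ Set.univ.pi fun i : D => Set.Ioc
          (M.margCdfLeft i (σ a i) (y a i)) (M.margCdf i (σ a i) (y a i)) :=
        fun h => hv fun i => h i trivial
      rw [Set.indicator_of_notMem hv, Set.indicator_of_notMem hv']
  rw [h1]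
  exact Measurable.lintegral_prod_right' ((hc.comp hup).indicator hA)

lemma measurable_logDensity {R : EuclideanSpace ℝ (Fin S)} (hR : R ∈ M.Γ) (hσ : Measurable σ)
    (hσG : ∀ a, σ a ∈ M.latentSpace) (hy : Measurable y) :
    Measurable fun a => M.logDensity R (σ a) (y a) :=
  ENNReal.measurable_log.comp (measurable_condDensity hR hσ hσG hy)

end Measurability

/-- The vector of truncated quantile functions. -/
noncomputable def quantileMap (M : Model k m Q S) (s u : Fin k → ℝ) : Fin k → ℝ :=
  fun i => truncQuantile (M.marginal i (s i)) (u i)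

lemma measurable_marginal_cdf {α : Type*} [MeasurableSpace α] {σ : α → (Fin k → ℝ)}
    (hσ : Measurable σ) (hσG : ∀ a, σ a ∈ M.latentSpace) (i : Fin k) (y : ℝ) :
    Measurable fun a => cdf (M.marginal i (σ a i)) y := by
  have hy : Measurable fun _ : α => fun _ : Fin k => y := measurable_const
  exact measurable_margCdf hσ hσG hy i

lemma measurable_quantileMap_uncurry {α : Type*} [MeasurableSpace α] {σ : α → (Fin k → ℝ)}
    (hσ : Measurable σ) (hσG : ∀ a, σ a ∈ M.latentSpace) :
    Measurable fun p : α × (Fin k → ℝ) => M.quantileMap (σ p.1) p.2 := by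
  refine measurable_pi_lambda _ fun i => ?_
  have h : Measurable fun p : α × ℝ => truncQuantile (M.marginal i (σ p.1 i)) p.2 :=
    measurable_truncQuantile_uncurry (ν := fun a => M.marginal i (σ a i))
      (measurable_marginal_cdf hσ hσG i)
  have h2 : Measurable fun p : α × (Fin k → ℝ) => (p.1, p.2 i) :=
    measurable_fst.prodMk ((measurable_pi_apply i).comp measurable_snd)
  have h3 : Measurable fun p : α × (Fin k → ℝ) =>
      truncQuantile (M.marginal i (σ p.1 i)) (p.2 i) := h.comp h2
  exact h3

lemma measurable_quantileMap (s : Fin k → ℝ) : Measurable (M.quantileMap s) :=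
  measurable_pi_lambda _ fun i => (measurable_truncQuantile _).comp (measurable_pi_apply i)

/-- If `U` has the copula distribution `C_R`, then `(F_i⁻¹(U_i))_i` has law `P_R(· | s)`. -/
theorem condDist_eq_map {R : EuclideanSpace ℝ (Fin S)} (hR : R ∈ M.Γ) {s : Fin k → ℝ}
    (hs : s ∈ M.latentSpace) :
    M.condDist R s = (copulaMeasure (M.copula R)).map (M.quantileMap s) := by
  have hc := (M.isCopulaDensity R hR).measurable
  have hprob : ∀ i, IsProbabilityMeasure (M.marginal i (s i)) := fun i =>
    isProbabilityMeasure_marginal (hs i trivial)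
  set L : Measure ℝ := volume.restrict (Set.Icc (0 : ℝ) 1)
  ext A hA
  set K : (Fin k → ℝ) × (Fin k → ℝ) → ℝ≥0∞ := fun p =>
    A.indicator (fun _ => M.copula R p.2) p.1 with hK
  have hKm : Measurable K := by
    have : K = (Prod.fst ⁻¹' A).indicator fun p => M.copula R p.2 := rfl
    rw [this]
    exact (hc.comp measurable_snd).indicator (measurable_fst hA)
  have hKd : Measurable fun p : (Fin k → ℝ) × (Fin k → ℝ) =>
      K (p.1, fun i => distTransform (M.marginal i (s i)) (p.1 i, p.2 i)) :=
    hKm.comp (measurable_fst.prodMk (measurable_pi_lambda _ fun i =>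
      (measurable_distTransform _).comp (((measurable_pi_apply i).comp measurable_fst).prodMk
        ((measurable_pi_apply i).comp measurable_snd))))
  set e := MeasurableEquiv.arrowProdEquivProdArrow ℝ ℝ (Fin k)
  have hKe : Measurable fun z => K (e z) := hKm.comp e.measurable
  have hgraph : ∀ i, Measurable fun u => (truncQuantile (M.marginal i (s i)) u, u) := fun i =>
    (measurable_truncQuantile _).prodMk measurable_id
  have hdist : ∀ i, Measurable fun q : ℝ × ℝ => (q.1, distTransform (M.marginal i (s i)) q) :=
    fun i => measurable_fst.prodMk (measurable_distTransform _)
  have hp1 : ∀ i, IsProbabilityMeasure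
      (L.map fun u => (truncQuantile (M.marginal i (s i)) u, u)) := fun i =>
    Measure.isProbabilityMeasure_map (hgraph i).aemeasurable
  have hp2 : ∀ i, IsProbabilityMeasure (((M.marginal i (s i)).prod L).map
      fun q : ℝ × ℝ => (q.1, distTransform (M.marginal i (s i)) q)) := fun i =>
    Measure.isProbabilityMeasure_map (hdist i).aemeasurable
  -- The one-dimensional identity is applied in each coordinate under the product measure; the
  -- copula density enters only through the integrand `K`.
  have hpi : (Measure.pi fun _ : Fin k => L).map
        (fun u i => (truncQuantile (M.marginal i (s i)) (u i), u i))
      = (Measure.pi fun i => (M.marginal i (s i)).prod L).map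
        fun q i => ((q i).1, distTransform (M.marginal i (s i)) (q i)) := by
    rw [Measure.pi_map_pi (fun i => (hgraph i).aemeasurable),
      Measure.pi_map_pi (fun i => (hdist i).aemeasurable)]
    exact congrArg _ (funext fun i => (map_prod_distTransform (hs i trivial)).symm)
  have hm1 : Measurable fun (u : Fin k → ℝ) i =>
      (truncQuantile (M.marginal i (s i)) (u i), u i) :=
    measurable_pi_lambda _ fun i => (hgraph i).comp (measurable_pi_apply i)
  have hm2 : Measurable fun (q : Fin k → ℝ × ℝ) i =>
      ((q i).1, distTransform (M.marginal i (s i)) (q i)) :=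
    measurable_pi_lambda _ fun i => (hdist i).comp (measurable_pi_apply i)
  have hrhs : (copulaMeasure (M.copula R)).map (M.quantileMap s) A
      = ∫⁻ z, K (e z) ∂((Measure.pi fun _ : Fin k => L).map
        (fun u i => (truncQuantile (M.marginal i (s i)) (u i), u i))) := by
    rw [Measure.map_apply (measurable_quantileMap s) hA, copulaMeasure_eq,
      withDensity_apply _ (measurable_quantileMap s hA), lintegral_map hKe hm1,
      ← lintegral_indicator (measurable_quantileMap s hA)]
    rfl
  have hmarg : Measure.pi (fun i => M.marginal i (s i))
      = M.refMeasure.withDensity fun y => ∏ i, M.dens i (s i) (y i) := by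
    have : ∀ i, SigmaFinite ((M.kind i).refMeasure.withDensity (M.dens i (s i))) := fun i =>
      have := hprob i
      inferInstanceAs (SigmaFinite (M.marginal i (s i)))
    exact pi_withDensity fun i => M.measurable_dens_right i (s i)
  rw [hrhs, hpi, lintegral_map hKe hm2]
  have hswap : ∫⁻ q, K (e fun i => ((q i).1, distTransform (M.marginal i (s i)) (q i)))
        ∂(Measure.pi fun i => (M.marginal i (s i)).prod L)
      = ∫⁻ p, K (p.1, fun i => distTransform (M.marginal i (s i)) (p.1 i, p.2 i))
        ∂((Measure.pi fun i => M.marginal i (s i)).prod (Measure.pi fun _ : Fin k => L)) :=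
    (measurePreserving_arrowProdEquivProdArrow ℝ ℝ (Fin k) (fun i => M.marginal i (s i))
      fun _ => L).lintegral_comp hKd
  have hdm : Measurable fun y : Fin k → ℝ => ∏ i, M.dens i (s i) (y i) :=
    Finset.measurable_prod _ fun i _ =>
      (M.measurable_dens_right i (s i)).comp (measurable_pi_apply i)
  rw [hswap, lintegral_prod _ hKd.aemeasurable, hmarg,
    lintegral_withDensity_eq_lintegral_mul _ hdm hKd.lintegral_prod_right', condDist, withDensity_apply _ hA,
    ← lintegral_indicator hA]
  refine lintegral_congr_ae ?_
  filter_upwards [condDensity_eq hR hs] with y hy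
  by_cases hyA : y ∈ A
  · rw [Set.indicator_of_mem hyA, hy]
    simp [hK, hyA, L]
  · rw [Set.indicator_of_notMem hyA]
    simp [hK, hyA]

lemma isProbabilityMeasure_condDist {R : EuclideanSpace ℝ (Fin S)} (hR : R ∈ M.Γ)
    {s : Fin k → ℝ} (hs : s ∈ M.latentSpace) : IsProbabilityMeasure (M.condDist R s) := by
  have := (M.isCopulaDensity R hR).isProbabilityMeasure
  rw [condDist_eq_map hR hs]
  exact Measure.isProbabilityMeasure_map (measurable_quantileMap s).aemeasurable

/-! ### The transition kernel -/

/-- The measurable retraction of `ℝ^k` onto the latent space fixing a base point `b`. -/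
noncomputable def clamp (M : Model k m Q S) (b s : Fin k → ℝ) : Fin k → ℝ :=
  open Classical in fun i => if s i ∈ M.G i then s i else b i

variable {b : Fin k → ℝ}

lemma measurable_clamp : Measurable (M.clamp b) := by
  classical
  refine measurable_pi_lambda _ fun i => ?_
  exact Measurable.ite (measurable_pi_apply i (M.measurableSet_G i)) (measurable_pi_apply i)
    measurable_const

lemma clamp_mem (hb : b ∈ M.latentSpace) (s : Fin k → ℝ) : M.clamp b s ∈ M.latentSpace := by
  intro i _
  by_cases h : s i ∈ M.G i
  · simp [clamp, h]
  · simpa [clamp, h] using hb i trivial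

lemma clamp_eq {s : Fin k → ℝ} (hs : s ∈ M.latentSpace) : M.clamp b s = s := by
  funext i
  simp [clamp, hs i trivial]

/-- The kernel `s ↦ P_R(· | s)`, extended to all of `ℝ^k` by the retraction. -/
noncomputable def condKernel (M : Model k m Q S) (hb : b ∈ M.latentSpace)
    {R : EuclideanSpace ℝ (Fin S)} (hR : R ∈ M.Γ) : Kernel (Fin k → ℝ) (Fin k → ℝ) where
  toFun s := M.condDist R (M.clamp b s)
  measurable' := by
    refine Measure.measurable_of_measurable_coe _ fun A hA => ?_
    have := (M.isCopulaDensity R hR).isProbabilityMeasure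
    -- The pushforward formula writes the mass of `A` as the copula mass of a section of a jointly
    -- measurable set.
    have h1 : (fun s => M.condDist R (M.clamp b s) A) = fun s => copulaMeasure (M.copula R)
        (Prod.mk s ⁻¹' ((fun p : (Fin k → ℝ) × (Fin k → ℝ) =>
          M.quantileMap (M.clamp b p.1) p.2) ⁻¹' A)) := by
      funext s
      rw [condDist_eq_map hR (clamp_mem hb s), Measure.map_apply (measurable_quantileMap _) hA]
      rfl
    rw [h1]
    exact measurable_measure_prodMk_left
      (measurable_quantileMap_uncurry measurable_clamp (clamp_mem hb) hA)

variable {hb : b ∈ M.latentSpace} {R : EuclideanSpace ℝ (Fin S)} {hR : R ∈ M.Γ}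

lemma condKernel_apply (s : Fin k → ℝ) : M.condKernel hb hR s = M.condDist R (M.clamp b s) := rfl

instance : IsMarkovKernel (M.condKernel hb hR) :=
  ⟨fun s => isProbabilityMeasure_condDist hR (clamp_mem hb s)⟩

lemma map_quantileMap_prod (μ : Measure (Fin k → ℝ)) [SFinite μ] :
    (μ.prod (copulaMeasure (M.copula R))).map
        (fun p => (p.1, M.quantileMap (M.clamp b p.1) p.2)) = μ.compProd (M.condKernel hb hR) := by
  have := (M.isCopulaDensity R hR).isProbabilityMeasure
  have hm : Measurable fun p : (Fin k → ℝ) × (Fin k → ℝ) =>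
      (p.1, M.quantileMap (M.clamp b p.1) p.2) :=
    measurable_fst.prodMk (measurable_quantileMap_uncurry measurable_clamp (clamp_mem hb))
  ext A hA
  rw [Measure.map_apply hm hA, Measure.prod_apply (hm hA), Measure.compProd_apply hA]
  refine lintegral_congr fun s => ?_
  rw [condKernel_apply, condDist_eq_map hR (clamp_mem hb s),
    Measure.map_apply (measurable_quantileMap _) (measurable_prodMk_left hA)]
  rfl

end Model

/-! ### The conditional law of the observations -/

namespace IsStationarySolution

variable {k m Q S : ℕ} {M : Model k m Q S} {Ω : Type*} [MeasurableSpace Ω] {P : Measure Ω}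
  {θ₀ : EuclideanSpace ℝ (Fin Q)} {R₀ : EuclideanSpace ℝ (Fin S)}
  {U : ℤ → Ω → (Fin k → ℝ)} {X : ℤ → Ω → (Fin m → ℝ)} {Y : ℤ → Ω → (Fin k → ℝ)}
  {lam : ℤ → EuclideanSpace ℝ (Fin Q) → Ω → (Fin k → ℝ)}

lemma measurable_U (h : IsStationarySolution M P θ₀ R₀ U X Y lam) (t : ℤ) : Measurable (U t) :=
  measurable_fst.comp (h.inputs_stationaryErgodic.measurable t)

lemma measurable_Y (h : IsStationarySolution M P θ₀ R₀ U X Y lam) (t : ℤ) : Measurable (Y t) :=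
  measurable_fst.comp (h.solution_stationaryErgodic.measurable t)

lemma measurable_lam (h : IsStationarySolution M P θ₀ R₀ U X Y lam) (t : ℤ)
    {θ : EuclideanSpace ℝ (Fin Q)} (hθ : θ ∈ M.Θ) : Measurable (lam t θ) :=
  ((measurable_pi_apply (⟨θ, hθ⟩ : M.Θ)).comp (measurable_snd.comp measurable_snd)).comp
    (h.solution_stationaryErgodic.measurable t)

/-- The noise at time `t` is independent of the latent variable at time `t`. -/
lemma map_lam_U (h : IsStationarySolution M P θ₀ R₀ U X Y lam) [IsProbabilityMeasure P] (t : ℤ) :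
    P.map (fun ω => (lam t θ₀ ω, U t ω))
      = (P.map (lam t θ₀)).prod (copulaMeasure (M.copula R₀)) := by
  -- Adaptedness at time `t` only makes `λ_t` measurable for `ℱ_t`. The recursion gives an almost
  -- surely equal version that is `ℱ_{t-1}`-measurable, hence independent of `U_t`.
  set L : Ω → (Fin k → ℝ) := fun ω =>
    M.g θ₀ (lam (t - 1) θ₀ ω) (Y (t - 1) ω) (X (t - 1) ω) with hL
  have hae : lam t θ₀ =ᵐ[P] L := h.latent_eq t θ₀ h.θ₀_mem
  have hX : Measurable[past U X (t - 1)] (X (t - 1)) := by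
    have h1 : Measurable[MeasurableSpace.comap (fun ω => (U (t - 1) ω, X (t - 1) ω)) inferInstance]
        (X (t - 1)) :=
      measurable_snd.comp (comap_measurable fun ω => (U (t - 1) ω, X (t - 1) ω))
    exact h1.mono (le_iSup (fun s : {s : ℤ // s ≤ t - 1} =>
      MeasurableSpace.comap (fun ω => (U s ω, X s ω)) inferInstance) ⟨t - 1, le_rfl⟩) le_rfl
  have hYL := h.adapted (t - 1)
  have hLm : Measurable[past U X (t - 1)] L :=
    (M.measurable_g θ₀ h.θ₀_mem).comp
      ((measurable_snd.comp hYL).prodMk ((measurable_fst.comp hYL).prodMk hX))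
  have hindep : IndepFun L (U t) P := by
    have h1 := indep_of_indep_of_le_right (h.noise_indep t) hLm.comap_le
    exact h1.symm
  have hlm : AEMeasurable L P := (h.measurable_lam t h.θ₀_mem).aemeasurable.congr hae
  have h2 := (indepFun_iff_map_prod_eq_prod_map_map hlm (h.measurable_U t).aemeasurable).1 hindep
  rw [Measure.map_congr (f := fun ω => (lam t θ₀ ω, U t ω)) (g := fun ω => (L ω, U t ω))
    (by filter_upwards [hae] with ω hω; rw [hω]), h2, h.noise_law, Measure.map_congr hae]

/-- Given the past, `Y_t` has law `P_{R₀}(· | λ_t(θ₀))`. -/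
theorem map_lam_Y (h : IsStationarySolution M P θ₀ R₀ U X Y lam) [IsProbabilityMeasure P]
    {b : Fin k → ℝ} (hb : b ∈ M.latentSpace) (t : ℤ) :
    P.map (fun ω => (lam t θ₀ ω, Y t ω))
      = (P.map (lam t θ₀)).compProd (M.condKernel hb h.R₀_mem) := by
  have hm : Measurable fun p : (Fin k → ℝ) × (Fin k → ℝ) =>
      (p.1, M.quantileMap (M.clamp b p.1) p.2) :=
    measurable_fst.prodMk (Model.measurable_quantileMap_uncurry Model.measurable_clamp
      (Model.clamp_mem hb))
  have hl := h.measurable_lam t h.θ₀_mem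
  have hu := h.measurable_U t
  rw [← Model.map_quantileMap_prod, ← h.map_lam_U t, Measure.map_map hm (hl.prodMk hu)]
  refine Measure.map_congr ?_
  -- Inside the open cube the truncated and the original quantile functions agree.
  have hmem : ∀ᵐ ω ∂P, ∀ i, U t ω i ∈ Set.Ioo (0 : ℝ) 1 := by
    have := ae_copulaMeasure_mem_Ioo (M.copula R₀)
    rw [← h.noise_law t] at this
    exact ae_of_ae_map hu.aemeasurable this
  filter_upwards [hmem, h.observation_eq t] with ω h1 h2
  refine Prod.ext rfl ?_
  funext i
  simp only [Function.comp_apply, Model.quantileMap,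
    Model.clamp_eq (h.latent_mem t θ₀ h.θ₀_mem ω), truncQuantile_of_mem (h1 i), h2 i]
  rfl

end IsStationarySolution

/-! ### Extended reals -/

lemma measurable_ereal_abs : Measurable EReal.abs :=
  EReal.measurable_of_measurable_real (by
    simp only [EReal.abs_def]
    exact (measurable_norm (α := ℝ)).ennreal_ofReal)

lemma EReal_ne_of_abs_lt_top {x : EReal} (h : x.abs < ⊤) : x ≠ ⊥ ∧ x ≠ ⊤ := by
  constructor <;> (rintro rfl; simp at h)

lemma enorm_toReal_le_abs (x : EReal) : ‖x.toReal‖ₑ ≤ x.abs := by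
  induction x with
  | bot => simp
  | top => simp
  | coe x => simp [EReal.abs_def, Real.enorm_eq_ofReal_abs]

lemma isClosed_abs_le {a : ℝ≥0∞} (ha : a ≠ ⊤) : IsClosed {x : EReal | x.abs ≤ a} := by
  have h : {x : EReal | x.abs ≤ a}
      = Set.Icc ((-a.toReal : ℝ) : EReal) ((a.toReal : ℝ) : EReal) := by
    ext x
    induction x with
    | bot => simp [ha]
    | top => simp [ha]
    | coe x =>
      rw [Set.mem_Icc, EReal.coe_le_coe_iff, EReal.coe_le_coe_iff, ← abs_le,
        ← ENNReal.ofReal_le_iff_le_toReal ha]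
      rfl
  rw [h]
  exact isClosed_Icc

lemma coe_finset_sum {ι : Type*} (s : Finset ι) (f : ι → ℝ) :
    ((∑ i ∈ s, f i : ℝ) : EReal) = ∑ i ∈ s, (f i : EReal) := by
  classical
  induction s using Finset.induction_on with
  | empty => simp
  | insert i s hi ih => rw [Finset.sum_insert hi, Finset.sum_insert hi, EReal.coe_add, ih]

lemma integrable_toReal_of_abs {α : Type*} [MeasurableSpace α] {μ : Measure α} {f : α → EReal}
    (hf : Measurable f) (h : ∫⁻ x, (f x).abs ∂μ < ⊤) :
    Integrable (fun x => (f x).toReal) μ :=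
  ⟨hf.ereal_toReal.aestronglyMeasurable,
    (lintegral_mono fun x => enorm_toReal_le_abs (f x)).trans_lt h⟩

/-! ### Relative entropy and total variation -/

section Entropy

/-- Apply `log z ≤ z - 1` at `z = √x` and double. This bounds relative entropy below by a
Hellinger-type quantity. -/
lemma sq_one_sub_sqrt_le {x : ℝ} (hx : 0 < x) : (1 - √x) ^ 2 ≤ x - 1 - Real.log x := by
  have h1 : Real.log x = 2 * Real.log (√x) := by
    rw [Real.log_sqrt hx.le]
    ring
  have h2 := Real.log_le_sub_one_of_pos (Real.sqrt_pos.2 hx)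
  nlinarith [Real.sq_sqrt hx.le]

/-- With `w = 1 - √x`, one has `1 - x = 2w - w² ≤ 2w ≤ ε + ε⁻¹ w²`. Being linear in the entropy
integrand, the bound can be integrated over any set. -/
lemma one_sub_le_of_pos {x ε : ℝ} (hx : 0 < x) (hε : 0 < ε) :
    1 - x ≤ ε + ε⁻¹ * (x - 1 - Real.log x) := by
  have h1 := mul_le_mul_of_nonneg_left (sq_one_sub_sqrt_le hx) (inv_pos.2 hε).le
  refine le_trans ?_ (add_le_add_right h1 ε)
  have h2 := Real.sq_sqrt hx.le
  have h3 : 0 ≤ ε⁻¹ * (ε - (1 - √x)) ^ 2 := by positivity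
  have h4 : ε⁻¹ * (ε - (1 - √x)) ^ 2 = ε - 2 * (1 - √x) + ε⁻¹ * (1 - √x) ^ 2 := by
    field_simp
    ring
  nlinarith [sq_nonneg (1 - √x)]

variable {α : Type*} [MeasurableSpace α] {μ : Measure α} {p q : α → ℝ≥0∞}

/-- A Pinsker-type inequality for densities, on a measurable set, together with nonnegativity of the
relative entropy. -/
lemma entropy_bounds (hp : Measurable p) (hq : Measurable q)
    [IsProbabilityMeasure (μ.withDensity p)] [IsProbabilityMeasure (μ.withDensity q)]
    (hlp : ∫⁻ x, (ENNReal.log (p x)).abs ∂(μ.withDensity p) < ⊤)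
    (hlq : ∫⁻ x, (ENNReal.log (q x)).abs ∂(μ.withDensity p) < ⊤) :
    0 ≤ ∫ x, (ENNReal.log (p x)).toReal ∂(μ.withDensity p)
        - ∫ x, (ENNReal.log (q x)).toReal ∂(μ.withDensity p) ∧
    ∀ ε > 0, ∀ A, MeasurableSet A → (μ.withDensity p).real A - (μ.withDensity q).real A
      ≤ ε + ε⁻¹ * (∫ x, (ENNReal.log (p x)).toReal ∂(μ.withDensity p)
        - ∫ x, (ENNReal.log (q x)).toReal ∂(μ.withDensity p)) := by
  set P := μ.withDensity p with hP
  set N := μ.withDensity q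
  have hlogp := ENNReal.measurable_log.comp hp
  have hlogq := ENNReal.measurable_log.comp hq
  have hip : Integrable (fun x => (ENNReal.log (p x)).toReal) P := integrable_toReal_of_abs hlogp hlp
  have hiq : Integrable (fun x => (ENNReal.log (q x)).toReal) P := integrable_toReal_of_abs hlogq hlq
  have hqp : Measurable fun x => q x / p x := hq.div hp
  set r : α → ℝ := fun x => (q x / p x).toReal with hr
  -- Only an inequality holds, because mass of `q` may be lost where `p` is `0` or `⊤`; there the
  -- product `p * (q / p)` is `0`.
  have hratio : ∀ A, MeasurableSet A → ∫⁻ x in A, q x / p x ∂P ≤ N A := by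
    intro A hA
    rw [hP, withDensity_apply _ hA, setLIntegral_withDensity_eq_setLIntegral_mul _ hp hqp hA]
    refine lintegral_mono fun x => ?_
    simp only [Pi.mul_apply]
    rcases eq_or_ne (p x) 0 with h0 | h0
    · simp [h0]
    · rcases eq_or_ne (p x) ⊤ with h1 | h1
      · simp [h1]
      · rw [ENNReal.mul_div_cancel h0 h1]
  have hlt : ∫⁻ x, q x / p x ∂P < ⊤ := by
    have := hratio Set.univ MeasurableSet.univ
    rw [Measure.restrict_univ, measure_univ] at this
    exact this.trans_lt ENNReal.one_lt_top
  have hri : Integrable r P := integrable_toReal_of_lintegral_ne_top hqp.aemeasurable hlt.ne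
  have hrA : ∀ A, MeasurableSet A → ∫ x in A, r x ∂P ≤ N.real A := by
    intro A hA
    simp only [hr]
    rw [integral_toReal hqp.aemeasurable
      (ae_restrict_of_ae (ae_lt_top hqp hlt.ne))]
    exact ENNReal.toReal_mono (measure_ne_top _ _) (hratio A hA)
  -- Integrability of both extended logarithms forces `p` and `q` to be positive and finite
  -- `P`-almost everywhere.
  have hfin : ∀ᵐ x ∂P, 0 < r x ∧ Real.log (r x)
      = (ENNReal.log (q x)).toReal - (ENNReal.log (p x)).toReal := by
    filter_upwards [ae_lt_top (measurable_ereal_abs.comp hlogp) hlp.ne,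
      ae_lt_top (measurable_ereal_abs.comp hlogq) hlq.ne] with x h1 h2
    obtain ⟨h1b, h1t⟩ := EReal_ne_of_abs_lt_top h1
    obtain ⟨h2b, h2t⟩ := EReal_ne_of_abs_lt_top h2
    simp only [Function.comp_apply, ne_eq, ENNReal.log_eq_bot_iff, ENNReal.log_eq_top_iff]
      at h1b h1t h2b h2t
    have hpx := ENNReal.toReal_pos h1b h1t
    have hqx := ENNReal.toReal_pos h2b h2t
    rw [ENNReal.log_pos_real h1b h1t, ENNReal.log_pos_real h2b h2t, EReal.toReal_coe,
      EReal.toReal_coe, hr]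
    simp only [ENNReal.toReal_div]
    exact ⟨div_pos hqx hpx, Real.log_div hqx.ne' hpx.ne'⟩
  set φ : α → ℝ := fun x =>
    r x - 1 - ((ENNReal.log (q x)).toReal - (ENNReal.log (p x)).toReal) with hφ
  have hφi : Integrable φ P := (hri.sub (integrable_const 1)).sub (hiq.sub hip)
  have hφ0 : 0 ≤ᵐ[P] φ := by
    filter_upwards [hfin] with x hx
    simp only [hφ, ← hx.2, Pi.zero_apply]
    exact (sq_nonneg _).trans (sq_one_sub_sqrt_le hx.1)
  -- Here `φ = r - 1 - log r`; as `∫ r ≤ 1`, its integral is at most the relative entropy.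
  have hφint : ∫ x, φ x ∂P ≤ ∫ x, (ENNReal.log (p x)).toReal ∂P
      - ∫ x, (ENNReal.log (q x)).toReal ∂P := by
    have h1 := hrA Set.univ MeasurableSet.univ
    rw [Measure.restrict_univ, probReal_univ] at h1
    have h2 : ∫ x, φ x ∂P = (∫ x, r x ∂P - 1) - (∫ x, (ENNReal.log (q x)).toReal ∂P
        - ∫ x, (ENNReal.log (p x)).toReal ∂P) := by
      rw [← integral_sub hiq hip, ← (show ∫ x, (r x - 1) ∂P = ∫ x, r x ∂P - 1 by
        rw [integral_sub hri (integrable_const 1)]; simp)]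
      exact integral_sub (hri.sub (integrable_const 1)) (hiq.sub hip)
    linarith
  refine ⟨(integral_nonneg_of_ae hφ0).trans hφint, fun ε hε A hA => ?_⟩
  have hψi : Integrable (fun x => ε + ε⁻¹ * φ x) P := (integrable_const ε).add (hφi.const_mul _)
  have h1 : P.real A - N.real A ≤ ∫ x in A, (1 - r x) ∂P := by
    rw [integral_sub (integrable_const 1).integrableOn hri.integrableOn]
    have := hrA A hA
    simp only [setIntegral_const, smul_eq_mul, mul_one]
    linarith
  have h2 : ∫ x in A, (1 - r x) ∂P ≤ ∫ x in A, (ε + ε⁻¹ * φ x) ∂P := by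
    refine integral_mono_ae ((integrable_const 1).sub hri).integrableOn hψi.integrableOn
      (ae_restrict_of_ae ?_)
    filter_upwards [hfin] with x hx
    simp only [hφ, ← hx.2]
    exact one_sub_le_of_pos hx.1 hε
  have h3 : ∫ x in A, (ε + ε⁻¹ * φ x) ∂P ≤ ∫ x, (ε + ε⁻¹ * φ x) ∂P := by
    refine setIntegral_le_integral hψi ?_
    filter_upwards [hφ0] with x hx
    have hx' : 0 ≤ φ x := hx
    simp only [Pi.zero_apply]
    positivity
  have h4 : ∫ x, (ε + ε⁻¹ * φ x) ∂P = ε + ε⁻¹ * ∫ x, φ x ∂P := by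
    rw [integral_add (integrable_const ε) (hφi.const_mul _), integral_const_mul]
    simp
  have h5 := mul_le_mul_of_nonneg_left hφint (inv_pos.2 hε).le
  linarith

end Entropy

lemma tvDist_nonneg {α : Type*} [MeasurableSpace α] (ν ν' : Measure α) : 0 ≤ tvDist ν ν' :=
  Real.iSup_nonneg fun _ => abs_nonneg _

/-- A one-sided bound suffices, since passing to complements changes the sign of the difference. -/
lemma tvDist_le {α : Type*} [MeasurableSpace α] {ν ν' : Measure α} [IsProbabilityMeasure ν]
    [IsProbabilityMeasure ν'] {c : ℝ}
    (h : ∀ A, MeasurableSet A → ν.real A - ν'.real A ≤ c) : tvDist ν' ν ≤ c := by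
  have : Nonempty {A : Set α // MeasurableSet A} := ⟨⟨∅, MeasurableSet.empty⟩⟩
  refine ciSup_le fun A => abs_le.2 ⟨by linarith [h A A.2], ?_⟩
  have h1 := h _ A.2.compl
  rw [probReal_compl_eq_one_sub A.2, probReal_compl_eq_one_sub A.2] at h1
  linarith

/-! ### Entropy bounds for the conditional laws -/

namespace Model

variable {k m Q S : ℕ} {M : Model k m Q S}

/-- The conditional expectation under `P_{R₀}(· | s)` of the log-density at `R`. -/
noncomputable def condLogLik (M : Model k m Q S) (R₀ R : EuclideanSpace ℝ (Fin S))
    (s : Fin k → ℝ) : ℝ :=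
  ∫ y, (M.logDensity R s y).toReal ∂(M.condDist R₀ s)

variable {R₀ R : EuclideanSpace ℝ (Fin S)} {s : Fin k → ℝ}

lemma measurable_condDensity_right (hR : R ∈ M.Γ) (hs : s ∈ M.latentSpace) :
    Measurable (M.condDensity R s) :=
  measurable_condDensity (σ := fun _ => s) hR measurable_const (fun _ => hs) measurable_id

lemma condLogLik_le (hR₀ : R₀ ∈ M.Γ) (hR : R ∈ M.Γ) (hs : s ∈ M.latentSpace)
    (h₀ : ∫⁻ y, (M.logDensity R₀ s y).abs ∂(M.condDist R₀ s) < ⊤)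
    (h : ∫⁻ y, (M.logDensity R s y).abs ∂(M.condDist R₀ s) < ⊤) :
    M.condLogLik R₀ R s ≤ M.condLogLik R₀ R₀ s := by
  have := isProbabilityMeasure_condDist hR₀ hs
  have := isProbabilityMeasure_condDist hR hs
  unfold condDist at *
  exact sub_nonneg.1 (entropy_bounds (μ := M.refMeasure) (measurable_condDensity_right hR₀ hs)
    (measurable_condDensity_right hR hs) h₀ h).1

lemma tvDist_condDist_le (hR₀ : R₀ ∈ M.Γ) (hR : R ∈ M.Γ) (hs : s ∈ M.latentSpace)
    (h₀ : ∫⁻ y, (M.logDensity R₀ s y).abs ∂(M.condDist R₀ s) < ⊤)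
    (h : ∫⁻ y, (M.logDensity R s y).abs ∂(M.condDist R₀ s) < ⊤) {ε : ℝ} (hε : 0 < ε) :
    tvDist (M.condDist R s) (M.condDist R₀ s)
      ≤ ε + ε⁻¹ * (M.condLogLik R₀ R₀ s - M.condLogLik R₀ R s) := by
  have := isProbabilityMeasure_condDist hR₀ hs
  have := isProbabilityMeasure_condDist hR hs
  unfold condDist at *
  exact tvDist_le fun A hA => (entropy_bounds (μ := M.refMeasure)
    (measurable_condDensity_right hR₀ hs) (measurable_condDensity_right hR hs) h₀ h).2 ε hε A hA

end Model

/-! ### The log-likelihood as a criterion along the state process -/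

namespace Model

variable {k m Q S : ℕ} (M : Model k m Q S)

/-- The log-density as a function of the parameters and of the state
`(Y_t, X_t, (λ_t(θ))_{θ ∈ Θ})` of the system. -/
noncomputable def stateLogLik (b : Fin k → ℝ) (q : M.Θ × M.Γ)
    (w : (Fin k → ℝ) × (Fin m → ℝ) × (M.Θ → Fin k → ℝ)) : EReal :=
  M.logDensity q.2 (M.clamp b (w.2.2 q.1)) w.1

variable {M} {b : Fin k → ℝ}

lemma measurable_stateLogLik (hb : b ∈ M.latentSpace) (q : M.Θ × M.Γ) :
    Measurable (M.stateLogLik b q) := by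
  have h1 : Measurable fun w : (Fin k → ℝ) × (Fin m → ℝ) × (M.Θ → Fin k → ℝ) =>
      M.clamp b (w.2.2 q.1) :=
    measurable_clamp.comp ((measurable_pi_apply _).comp (measurable_snd.comp measurable_snd))
  exact measurable_logDensity q.2.2 h1 (fun w => clamp_mem hb _) measurable_fst

end Model

namespace IsStationarySolution

variable {k m Q S : ℕ} {M : Model k m Q S} {Ω : Type*} [MeasurableSpace Ω] {P : Measure Ω}
  {θ₀ : EuclideanSpace ℝ (Fin Q)} {R₀ : EuclideanSpace ℝ (Fin S)}
  {U : ℤ → Ω → (Fin k → ℝ)} {X : ℤ → Ω → (Fin m → ℝ)} {Y : ℤ → Ω → (Fin k → ℝ)}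
  {lam : ℤ → EuclideanSpace ℝ (Fin Q) → Ω → (Fin k → ℝ)} {b : Fin k → ℝ}

/-- The state process. -/
local notation "stateProcess" => fun (t : ℤ) ω => (Y t ω, X t ω, fun θ : M.Θ => lam t θ ω)

lemma stateLogLik_eq (h : IsStationarySolution M P θ₀ R₀ U X Y lam) (q : M.Θ × M.Γ) (t : ℤ)
    (ω : Ω) : M.stateLogLik b q (stateProcess t ω) = logLik M Y lam t q.1 q.2 ω := by
  simp only [Model.stateLogLik, logLik]
  rw [Model.clamp_eq (h.latent_mem t q.1 q.1.2 ω)]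

/-- Under (A14) the log-likelihoods are almost surely finite, and they form a regular criterion. -/
theorem isRegularCriterion (h : IsStationarySolution M P θ₀ R₀ U X Y lam)
    (hb : b ∈ M.latentSpace)
    (hcont : ∀ t : ℤ, ∀ᵐ ω ∂P,
      ContinuousOn (fun q : EuclideanSpace ℝ (Fin Q) × EuclideanSpace ℝ (Fin S) =>
        logLik M Y lam t q.1 q.2 ω) (M.Θ ×ˢ M.Γ))
    (hint : ∫⁻ ω, ⨆ q ∈ M.Θ ×ˢ M.Γ, (logLik M Y lam 1 q.1 q.2 ω).abs ∂P < ⊤) :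
    (∀ᵐ ω ∂P, ∀ (t : ℤ) (q : M.Θ × M.Γ), (logLik M Y lam t q.1 q.2 ω).abs < ⊤) ∧
    ∃ g, IsRegularCriterion (fun q w => (M.stateLogLik b q w).toReal) g (stateProcess) P := by
  have hZ := h.solution_stationaryErgodic
  have hne : Nonempty (M.Θ × M.Γ) := ⟨⟨θ₀, h.θ₀_mem⟩, ⟨R₀, h.R₀_mem⟩⟩
  -- The supremum over all parameters need not be measurable, so a dense sequence is used.
  set G : (Fin k → ℝ) × (Fin m → ℝ) × (M.Θ → Fin k → ℝ) → ℝ≥0∞ := fun w =>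
    ⨆ i, (M.stateLogLik b (TopologicalSpace.denseSeq (M.Θ × M.Γ) i) w).abs with hG
  have hGm : Measurable G := Measurable.iSup fun i =>
    measurable_ereal_abs.comp (Model.measurable_stateLogLik hb _)
  have hG1 : ∫⁻ ω, G (stateProcess 1 ω) ∂P < ⊤ := by
    refine (lintegral_mono fun ω => iSup_le fun i => ?_).trans_lt hint
    rw [h.stateLogLik_eq]
    set q := TopologicalSpace.denseSeq (M.Θ × M.Γ) i
    exact le_iSup₂_of_le (f := fun (q : EuclideanSpace ℝ (Fin Q) × EuclideanSpace ℝ (Fin S))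
      (_ : q ∈ M.Θ ×ˢ M.Γ) => (logLik M Y lam 1 q.1 q.2 ω).abs)
      ((q.1 : EuclideanSpace ℝ (Fin Q)), (q.2 : EuclideanSpace ℝ (Fin S))) ⟨q.1.2, q.2.2⟩ le_rfl
  have hG1m : Measurable fun ω => G (stateProcess 1 ω) := hGm.comp (hZ.measurable 1)
  -- Integrability is given at time `1` only; stationarity carries finiteness to every time.
  have hfin : ∀ᵐ ω ∂P, ∀ t, G (stateProcess t ω) < ⊤ :=
    ae_all_iff.2 fun t => hZ.ae_comp_of_ae (p := fun w => G w < ⊤) (s := 1)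
      (measurableSet_lt hGm measurable_const) (ae_lt_top hG1m hG1.ne) t
  have hreg : ∀ᵐ ω ∂P, ∀ t, Continuous (fun q => M.stateLogLik b q (stateProcess t ω)) ∧
      G (stateProcess t ω) < ⊤ ∧
      ∀ q, (M.stateLogLik b q (stateProcess t ω)).abs ≤ G (stateProcess t ω) := by
    filter_upwards [hfin, ae_all_iff.2 hcont] with ω h1 h2 t
    have hc : Continuous fun q => M.stateLogLik b q (stateProcess t ω) := by
      simp_rw [h.stateLogLik_eq]
      refine (h2 t).comp_continuous (f := fun q : M.Θ × M.Γ =>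
        ((q.1 : EuclideanSpace ℝ (Fin Q)), (q.2 : EuclideanSpace ℝ (Fin S)))) ?_ ?_
      · fun_prop
      · exact fun q => ⟨q.1.2, q.2.2⟩
    refine ⟨hc, h1 t, fun q => ?_⟩
    -- Since `G` is finite here, the bound is a closed condition on the value; continuity extends it
    -- from the dense sequence.
    refine (TopologicalSpace.denseRange_denseSeq (M.Θ × M.Γ)).induction_on
      (p := fun q => (M.stateLogLik b q (stateProcess t ω)).abs ≤ G (stateProcess t ω)) q
      ((isClosed_abs_le (h1 t).ne).preimage hc) fun i => ?_
    exact le_iSup (fun i => (M.stateLogLik b (TopologicalSpace.denseSeq (M.Θ × M.Γ) i)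
      (stateProcess t ω)).abs) i
  refine ⟨?_, fun w => (G w).toReal, fun q => (Model.measurable_stateLogLik hb q).ereal_toReal,
    integrable_toReal_of_lintegral_ne_top hG1m.aemeasurable hG1.ne, ?_⟩
  · filter_upwards [hreg] with ω hω t q
    rw [← h.stateLogLik_eq (b := b)]
    exact ((hω t).2.2 q).trans_lt (hω t).2.1
  · filter_upwards [hreg] with ω hω t
    obtain ⟨hc, ht, hle⟩ := hω t
    constructor
    · refine EReal.continuousOn_toReal.comp_continuous hc fun q => ?_
      have := EReal_ne_of_abs_lt_top ((hle q).trans_lt ht)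
      simp [this.1, this.2]
    · intro q
      have h1 := (enorm_toReal_le_abs (M.stateLogLik b q (stateProcess t ω))).trans (hle q)
      rw [Real.enorm_eq_ofReal_abs] at h1
      exact (ENNReal.ofReal_le_iff_le_toReal ht.ne).1 h1

/-- The mean log-likelihood is the expectation of the conditional mean log-likelihood. -/
theorem integral_condLogLik (h : IsStationarySolution M P θ₀ R₀ U X Y lam)
    [IsProbabilityMeasure P] (hb : b ∈ M.latentSpace) {R : EuclideanSpace ℝ (Fin S)}
    (hR : R ∈ M.Γ) (hint : Integrable (fun ω => (logLik M Y lam 1 θ₀ R ω).toReal) P) :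
    Integrable (fun s => M.condLogLik R₀ R (M.clamp b s)) (P.map (lam 1 θ₀)) ∧
    ∫ s, M.condLogLik R₀ R (M.clamp b s) ∂(P.map (lam 1 θ₀)) = meanLogLik M Y lam P θ₀ R := by
  have hlm := h.measurable_lam 1 h.θ₀_mem
  have : IsProbabilityMeasure (P.map (lam 1 θ₀)) := Measure.isProbabilityMeasure_map hlm.aemeasurable
  have hpm : Measurable fun ω => (lam 1 θ₀ ω, Y 1 ω) := hlm.prodMk (h.measurable_Y 1)
  set φ : (Fin k → ℝ) × (Fin k → ℝ) → ℝ := fun p =>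
    (M.logDensity R (M.clamp b p.1) p.2).toReal with hφ
  have hφm : Measurable φ := (Model.measurable_logDensity hR
    (Model.measurable_clamp.comp measurable_fst) (fun p => Model.clamp_mem hb p.1)
    measurable_snd).ereal_toReal
  have hcomp : ∀ ω, φ (lam 1 θ₀ ω, Y 1 ω) = (logLik M Y lam 1 θ₀ R ω).toReal := fun ω => by
    simp only [hφ, Model.clamp_eq (h.latent_mem 1 θ₀ h.θ₀_mem ω)]
    rfl
  have hφi : Integrable φ ((P.map (lam 1 θ₀)).compProd (M.condKernel hb h.R₀_mem)) := by
    rw [← h.map_lam_Y hb 1, integrable_map_measure hφm.aestronglyMeasurable hpm.aemeasurable]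
    exact hint.congr (Eventually.of_forall fun ω => (hcomp ω).symm)
  have hφi' : Integrable φ ((Kernel.compProd (Kernel.const Unit (P.map (lam 1 θ₀)))
      (Kernel.prodMkLeft Unit (M.condKernel hb h.R₀_mem))) ()) := hφi
  refine ⟨hφi'.integral_compProd, ?_⟩
  have h1 := Measure.integral_compProd hφi
  rw [← h.map_lam_Y hb 1, integral_map hpm.aemeasurable hφm.aestronglyMeasurable] at h1
  simp_rw [hcomp] at h1
  exact h1.symm

end IsStationarySolution

/-- Where the log-likelihoods are finite, the averaged criterion is a real number. -/
lemma avgLogLik_eq_coe {k m Q S : ℕ} {M : Model k m Q S} {Ω : Type*}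
    {Y : ℤ → Ω → (Fin k → ℝ)} {lam : ℤ → EuclideanSpace ℝ (Fin Q) → Ω → (Fin k → ℝ)} {n : ℕ} {θ : EuclideanSpace ℝ (Fin Q)} {R : EuclideanSpace ℝ (Fin S)}
    {ω : Ω} (h : ∀ t : ℤ, (logLik M Y lam t θ R ω).abs < ⊤) :
    avgLogLik M Y lam n θ R ω
      = (((∑ t ∈ Finset.Icc 1 n, (logLik M Y lam (t : ℤ) θ R ω).toReal) / n : ℝ) : EReal) := by
  have h1 : ∀ t : ℕ, logLik M Y lam (t : ℤ) θ R ω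
      = (((logLik M Y lam (t : ℤ) θ R ω).toReal : ℝ) : EReal) := fun t =>
    have h2 := EReal_ne_of_abs_lt_top (h t)
    (EReal.coe_toReal h2.2 h2.1).symm
  rw [avgLogLik, EReal.coe_div, coe_finset_sum, EReal.coe_coe_eq_natCast]
  congr 1
  exact Finset.sum_congr rfl fun t _ => h1 t

/-- A function continuous on a compact set and constant on a nonempty subset `I` tends to this
constant along sequences approaching `I`. -/
lemma tendsto_of_tendsto_infDist {E : Type*} [PseudoMetricSpace E] {K I : Set E}
    (hK : IsCompact K) (hI : I ⊆ K) (hne : I.Nonempty) {F : E → ℝ} (hF : ContinuousOn F K) {c : ℝ}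
    (hc : ∀ x ∈ I, F x = c) {x : ℕ → E} (hx : ∀ᶠ n in atTop, x n ∈ K)
    (hlim : Tendsto (fun n => Metric.infDist (x n) I) atTop (𝓝 0)) :
    Tendsto (fun n => F (x n)) atTop (𝓝 c) := by
  have huc := hK.uniformContinuousOn_of_continuous hF
  rw [Metric.uniformContinuousOn_iff] at huc
  refine Metric.tendsto_nhds.2 fun ε hε => ?_
  obtain ⟨δ, hδ, h⟩ := huc ε hε
  filter_upwards [hx, hlim.eventually_lt_const hδ] with n hn hd
  obtain ⟨z, hz, hdist⟩ := (Metric.infDist_lt_iff hne).1 hd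
  rw [← hc z hz]
  exact h _ hn z (hI hz) hdist

/-! ### Consistency and vanishing of the conditional relative entropy -/

section Consistency

variable {k m Q S : ℕ} {M : Model k m Q S} {Ω : Type*} [MeasurableSpace Ω] {P : Measure Ω}
  {θ₀ : EuclideanSpace ℝ (Fin Q)} {R₀ : EuclideanSpace ℝ (Fin S)}
  {U : ℤ → Ω → (Fin k → ℝ)} {X : ℤ → Ω → (Fin m → ℝ)} {Y : ℤ → Ω → (Fin k → ℝ)}
  {lam : ℤ → EuclideanSpace ℝ (Fin Q) → Ω → (Fin k → ℝ)}

/-- Consistency of the copula estimator, up to identifiability. -/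
theorem IsStationarySolution.ae_tendsto_infDist_optimalSet [IsProbabilityMeasure P]
    (hsol : IsStationarySolution M P θ₀ R₀ U X Y lam) (hΓ : IsCompact M.Γ)
    (hcont : ∀ t : ℤ, ∀ᵐ ω ∂P,
      ContinuousOn (fun q : EuclideanSpace ℝ (Fin Q) × EuclideanSpace ℝ (Fin S) =>
        logLik M Y lam t q.1 q.2 ω) (M.Θ ×ˢ M.Γ))
    (hint : ∫⁻ ω, ⨆ q ∈ M.Θ ×ˢ M.Γ, (logLik M Y lam 1 q.1 q.2 ω).abs ∂P < ⊤)
    (hmax : ∀ R ∈ M.Γ, meanLogLik M Y lam P θ₀ R ≤ meanLogLik M Y lam P θ₀ R₀)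
    {θhat : ℕ → Ω → EuclideanSpace ℝ (Fin Q)}
    (hθhat_mem : ∀ n, ∀ᵐ ω ∂P, θhat n ω ∈ M.Θ)
    (hθhat : ∀ᵐ ω ∂P, Tendsto (fun n => θhat n ω) atTop (𝓝 θ₀))
    {Rhat : ℕ → Ω → EuclideanSpace ℝ (Fin S)}
    (hRhat : ∀ n, 1 ≤ n → ∀ᵐ ω ∂P, Rhat n ω ∈ M.Γ ∧
      IsMaxOn (fun R => avgLogLik M Y lam n (θhat n ω) R ω) M.Γ (Rhat n ω)) :
    ∀ᵐ ω ∂P, Tendsto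
      (fun n => Metric.infDist (Rhat n ω) (optimalSet M Y lam P θ₀ R₀)) atTop (𝓝 0) := by
  -- Any realized latent value can serve as the base point of the retraction.
  obtain ⟨ω₀⟩ := nonempty_of_isProbabilityMeasure P
  have hb : lam 0 θ₀ ω₀ ∈ M.latentSpace := hsol.latent_mem 0 θ₀ hsol.θ₀_mem ω₀
  obtain ⟨hfin, g, hcrit⟩ := hsol.isRegularCriterion hb hcont hint
  have : CompactSpace M.Γ := isCompact_iff_compactSpace.1 hΓ
  set I₀ := optimalSet M Y lam P θ₀ R₀
  set θ₀' : M.Θ := ⟨θ₀, hsol.θ₀_mem⟩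
  set R₀' : M.Γ := ⟨R₀, hsol.R₀_mem⟩
  have hRhat' : ∀ᵐ ω ∂P, ∀ n, 1 ≤ n → Rhat n ω ∈ M.Γ ∧
      IsMaxOn (fun R => avgLogLik M Y lam n (θhat n ω) R ω) M.Γ (Rhat n ω) :=
    ae_all_iff.2 fun n => by
      by_cases hn : 1 ≤ n
      · filter_upwards [hRhat n hn] with ω hω _ using hω
      · exact Eventually.of_forall fun ω h => absurd h hn
  have key : ∀ δ > 0, ∀ᵐ ω ∂P, ∀ᶠ n in atTop, Metric.infDist (Rhat n ω) I₀ < δ := by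
    intro δ hδ
    set C : Set M.Γ := {R | δ ≤ Metric.infDist (R : EuclideanSpace ℝ (Fin S)) I₀} with hC
    have hCc : IsCompact C := (isClosed_le continuous_const
      ((Metric.continuous_infDist_pt I₀).comp continuous_subtype_val)).isCompact
    obtain ⟨ε, hε, hlt⟩ := hcrit.exists_ball_sum_lt hsol.solution_stationaryErgodic θ₀' R₀' hCc (by
      intro R hR
      simp_rw [hsol.stateLogLik_eq]
      refine lt_of_le_of_ne (hmax R R.2) fun heq => ?_
      have hmem : (R : EuclideanSpace ℝ (Fin S)) ∈ I₀ := ⟨R.2, heq⟩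
      have h0 : δ ≤ Metric.infDist (R : EuclideanSpace ℝ (Fin S)) I₀ := hR
      rw [Metric.infDist_zero_of_mem hmem] at h0
      exact absurd hδ (not_lt.2 h0))
    simp_rw [hsol.stateLogLik_eq] at hlt
    filter_upwards [hlt, hfin, hRhat', ae_all_iff.2 hθhat_mem, hθhat] with ω h1 h2 h3 h4 h5
    filter_upwards [h1, h5 (Metric.ball_mem_nhds θ₀ hε), eventually_ge_atTop 1] with n hn1 hn2 hn3
    obtain ⟨hmem, hmaxn⟩ := h3 n hn3
    by_contra hnot
    -- A maximizer far from `I₀` would have a strictly smaller likelihood sum than `R₀`, which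
    -- contradicts maximality once the extended real averages are read as real numbers.
    have h6 := hn1 ⟨θhat n ω, h4 n⟩ hn2 ⟨Rhat n ω, hmem⟩ (not_lt.1 hnot)
    have h7 : avgLogLik M Y lam n (θhat n ω) R₀ ω
        ≤ avgLogLik M Y lam n (θhat n ω) (Rhat n ω) ω := hmaxn hsol.R₀_mem
    rw [avgLogLik_eq_coe fun t => h2 t (⟨θhat n ω, h4 n⟩, R₀'),
      avgLogLik_eq_coe fun t => h2 t (⟨θhat n ω, h4 n⟩, ⟨Rhat n ω, hmem⟩),
      EReal.coe_le_coe_iff] at h7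
    have hn0 : (0 : ℝ) < n := by exact_mod_cast hn3
    exact absurd h6 (not_lt.2 ((div_le_div_iff_of_pos_right hn0).1 h7))
  have hall : ∀ᵐ ω ∂P, ∀ j : ℕ, ∀ᶠ n in atTop,
      Metric.infDist (Rhat n ω) I₀ < 1 / ((j : ℝ) + 1) :=
    ae_all_iff.2 fun j => key _ Nat.one_div_pos_of_nat
  filter_upwards [hall] with ω hω
  refine tendsto_order.2 ⟨fun a ha => Eventually.of_forall fun n =>
    ha.trans_le Metric.infDist_nonneg, fun a ha => ?_⟩
  obtain ⟨j, hj⟩ := exists_nat_one_div_lt ha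
  exact (hω j).mono fun n hn => hn.trans hj

/-- The conditional laws at all optimal parameters have the same conditional mean log-likelihood,
for almost all values of the latent variable. -/
theorem IsStationarySolution.exists_measurableSet_condLogLik_eq [IsProbabilityMeasure P]
    (hsol : IsStationarySolution M P θ₀ R₀ U X Y lam)
    (hcont : ∀ t : ℤ, ∀ᵐ ω ∂P,
      ContinuousOn (fun q : EuclideanSpace ℝ (Fin Q) × EuclideanSpace ℝ (Fin S) =>
        logLik M Y lam t q.1 q.2 ω) (M.Θ ×ˢ M.Γ))
    (hint : ∫⁻ ω, ⨆ q ∈ M.Θ ×ˢ M.Γ, (logLik M Y lam 1 q.1 q.2 ω).abs ∂P < ⊤)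
    (hKL_int : ∀ s ∈ M.latentSpace, ∀ R ∈ M.Γ,
      ∫⁻ y, (M.logDensity R s y).abs ∂(M.condDist R₀ s) < ⊤)
    (hKL_cont : ∀ s ∈ M.latentSpace, ContinuousOn (fun R => M.condLogLik R₀ R s) M.Γ) :
    ∃ Λ : Set (Fin k → ℝ), MeasurableSet Λ ∧ Λ ⊆ M.latentSpace ∧ P ((lam 0 θ₀) ⁻¹' Λ) = 1 ∧
      ∀ s ∈ Λ, ∀ R ∈ optimalSet M Y lam P θ₀ R₀, M.condLogLik R₀ R s = M.condLogLik R₀ R₀ s := by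
  obtain ⟨ω₀⟩ := nonempty_of_isProbabilityMeasure P
  set b := lam 0 θ₀ ω₀
  have hb : b ∈ M.latentSpace := hsol.latent_mem 0 θ₀ hsol.θ₀_mem ω₀
  obtain ⟨-, g, hcrit⟩ := hsol.isRegularCriterion hb hcont hint
  have hZ := hsol.solution_stationaryErgodic
  set I₀ := optimalSet M Y lam P θ₀ R₀ with hI₀
  have hne : Nonempty I₀ := ⟨⟨R₀, hsol.R₀_mem, rfl⟩⟩
  set ν := P.map (lam 1 θ₀)
  have hν : ν = P.map (lam 0 θ₀) := by
    have hm : Measurable fun w : (Fin k → ℝ) × (Fin m → ℝ) × (M.Θ → Fin k → ℝ) =>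
        w.2.2 ⟨θ₀, hsol.θ₀_mem⟩ :=
      (measurable_pi_apply _).comp (measurable_snd.comp measurable_snd)
    have h1 := congrArg (fun μ => μ.map fun w : (Fin k → ℝ) × (Fin m → ℝ) × (M.Θ → Fin k → ℝ) =>
        w.2.2 ⟨θ₀, hsol.θ₀_mem⟩) (hZ.map_eq 1 0)
    rw [Measure.map_map hm (hZ.measurable 1), Measure.map_map hm (hZ.measurable 0)] at h1
    exact h1
  have hmean : ∀ R ∈ M.Γ, Integrable (fun s => M.condLogLik R₀ R (M.clamp b s)) ν ∧
      ∫ s, M.condLogLik R₀ R (M.clamp b s) ∂ν = meanLogLik M Y lam P θ₀ R := by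
    intro R hR
    refine hsol.integral_condLogLik hb hR ?_
    refine hcrit.integrable_bound.mono' (((Model.measurable_stateLogLik hb
      (⟨θ₀, hsol.θ₀_mem⟩, ⟨R, hR⟩)).ereal_toReal.comp
        (hZ.measurable 1)).aestronglyMeasurable.congr (Eventually.of_forall fun ω => ?_)) ?_
    · simp only [Function.comp_apply, hsol.stateLogLik_eq]
    · filter_upwards [hcrit.regular] with ω hω
      have h1 := (hω 1).2 (⟨θ₀, hsol.θ₀_mem⟩, ⟨R, hR⟩)
      rwa [hsol.stateLogLik_eq] at h1
  have hae : ∀ R ∈ I₀, ∀ᵐ s ∂ν,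
      M.condLogLik R₀ R (M.clamp b s) = M.condLogLik R₀ R₀ (M.clamp b s) := by
    rintro R ⟨hR, hRmean⟩
    obtain ⟨hi, he⟩ := hmean R hR
    obtain ⟨hi₀, he₀⟩ := hmean R₀ hsol.R₀_mem
    -- This difference is the relative entropy at `s`. It is nonnegative with zero mean when `R ∈
    -- I₀`, so it vanishes almost everywhere.
    have hnn : 0 ≤ᵐ[ν] fun s =>
        M.condLogLik R₀ R₀ (M.clamp b s) - M.condLogLik R₀ R (M.clamp b s) :=
      Eventually.of_forall fun s => sub_nonneg.2 (Model.condLogLik_le hsol.R₀_mem hR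
        (Model.clamp_mem hb s) (hKL_int _ (Model.clamp_mem hb s) _ hsol.R₀_mem)
        (hKL_int _ (Model.clamp_mem hb s) _ hR))
    have h0 := (integral_eq_zero_iff_of_nonneg_ae hnn (hi₀.sub hi)).1 (by
      rw [integral_sub hi₀ hi, he, he₀, hRmean, sub_self])
    filter_upwards [h0] with s hs
    exact (sub_eq_zero.1 hs).symm
  -- The null set above depends on `R`; a dense sequence in `I₀` keeps the union null, and
  -- continuity in `R` recovers all of `I₀`.
  have hall : ∀ᵐ s ∂ν, ∀ j, M.condLogLik R₀ (TopologicalSpace.denseSeq I₀ j) (M.clamp b s)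
      = M.condLogLik R₀ R₀ (M.clamp b s) :=
    ae_all_iff.2 fun j => hae _ (TopologicalSpace.denseSeq I₀ j).2
  obtain ⟨N, hsub, hNm, hN0⟩ := exists_measurable_superset_of_null hall
  have hGm : MeasurableSet M.latentSpace := MeasurableSet.univ_pi M.measurableSet_G
  have hlm := hsol.measurable_lam 0 hsol.θ₀_mem
  refine ⟨M.latentSpace \ N, hGm.diff hNm, Set.sdiff_subset, ?_, ?_⟩
  · have hae0 : ∀ᵐ ω ∂P, lam 0 θ₀ ω ∈ M.latentSpace \ N := by
      rw [hν] at hN0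
      filter_upwards [ae_of_ae_map hlm.aemeasurable (measure_eq_zero_iff_ae_notMem.1 hN0)]
        with ω hω
      exact ⟨hsol.latent_mem 0 θ₀ hsol.θ₀_mem ω, hω⟩
    exact (prob_compl_eq_zero_iff (hlm (hGm.diff hNm))).1 hae0
  · rintro s ⟨hs, hsN⟩ R hR
    have hgood : ∀ j, M.condLogLik R₀ (TopologicalSpace.denseSeq I₀ j) s
        = M.condLogLik R₀ R₀ s := by
      by_contra hbad
      refine hsN (hsub ?_)
      rw [← Model.clamp_eq (b := b) hs] at hbad
      exact hbad
    have hcs : Continuous fun R : I₀ => M.condLogLik R₀ (R : EuclideanSpace ℝ (Fin S)) s :=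
      (hKL_cont s hs).comp_continuous continuous_subtype_val fun R => R.2.1
    exact (TopologicalSpace.denseRange_denseSeq I₀).induction_on
      (p := fun R : I₀ => M.condLogLik R₀ (R : EuclideanSpace ℝ (Fin S)) s = M.condLogLik R₀ R₀ s)
      ⟨R, hR⟩ (isClosed_eq hcs continuous_const) hgood

end Consistency

end MixedSeries

theorem mainTheorem5 {k m Q S : ℕ} (M : MixedSeries.Model k m Q S)
    {Ω : Type*} [MeasurableSpace Ω] (P : Measure Ω) [IsProbabilityMeasure P]
    (θ₀ : EuclideanSpace ℝ (Fin Q)) (R₀ : EuclideanSpace ℝ (Fin S))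
    (U : ℤ → Ω → (Fin k → ℝ)) (X : ℤ → Ω → (Fin m → ℝ)) (Y : ℤ → Ω → (Fin k → ℝ))
    (lam : ℤ → EuclideanSpace ℝ (Fin Q) → Ω → (Fin k → ℝ))
    (hsol : MixedSeries.IsStationarySolution M P θ₀ R₀ U X Y lam)
    -- A13
    (hΘ : IsCompact M.Θ) (hΓ : IsCompact M.Γ)
    -- A14
    (hcont : ∀ t : ℤ, ∀ᵐ ω ∂P,
      ContinuousOn (fun q : EuclideanSpace ℝ (Fin Q) × EuclideanSpace ℝ (Fin S) =>
        MixedSeries.logLik M Y lam t q.1 q.2 ω) (M.Θ ×ˢ M.Γ))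
    (hint : ∫⁻ ω, ⨆ q ∈ M.Θ ×ˢ M.Γ, (MixedSeries.logLik M Y lam 1 q.1 q.2 ω).abs ∂P < ⊤)
    -- A15
    (hmax : ∀ R ∈ M.Γ,
      MixedSeries.meanLogLik M Y lam P θ₀ R ≤ MixedSeries.meanLogLik M Y lam P θ₀ R₀)
    -- A16
    (hKL_int : ∀ s ∈ M.latentSpace, ∀ R ∈ M.Γ,
      ∫⁻ y, (M.logDensity R s y).abs ∂(M.condDist R₀ s) < ⊤)
    (hKL_cont : ∀ s ∈ M.latentSpace,
      ContinuousOn (fun R => ∫ y, (M.logDensity R s y).toReal ∂(M.condDist R₀ s)) M.Γ)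
    -- a strongly consistent estimator of `θ₀`
    (θhat : ℕ → Ω → EuclideanSpace ℝ (Fin Q))
    (hθhat_mem : ∀ n, ∀ᵐ ω ∂P, θhat n ω ∈ M.Θ)
    (hθhat : ∀ᵐ ω ∂P, Tendsto (fun n => θhat n ω) atTop (𝓝 θ₀))
    -- the likelihood estimator of `R₀`
    (Rhat : ℕ → Ω → EuclideanSpace ℝ (Fin S))
    (hRhat : ∀ n, 1 ≤ n → ∀ᵐ ω ∂P, Rhat n ω ∈ M.Γ ∧
      IsMaxOn (fun R => MixedSeries.avgLogLik M Y lam n (θhat n ω) R ω) M.Γ (Rhat n ω)) :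
    (∀ᵐ ω ∂P, Tendsto
      (fun n => Metric.infDist (Rhat n ω) (MixedSeries.optimalSet M Y lam P θ₀ R₀))
      atTop (𝓝 0)) ∧
    ∃ Λ : Set (Fin k → ℝ), MeasurableSet Λ ∧ Λ ⊆ M.latentSpace ∧
      P ((lam 0 θ₀) ⁻¹' Λ) = 1 ∧
      ∀ s ∈ Λ, ∀ᵐ ω ∂P, Tendsto
        (fun n => MixedSeries.tvDist (M.condDist (Rhat n ω) s) (M.condDist R₀ s))
        atTop (𝓝 0) := by
  have h1 := hsol.ae_tendsto_infDist_optimalSet hΓ hcont hint hmax hθhat_mem hθhat hRhat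
  refine ⟨h1, ?_⟩
  have hR₀ : R₀ ∈ MixedSeries.optimalSet M Y lam P θ₀ R₀ := ⟨hsol.R₀_mem, rfl⟩
  obtain ⟨Λ, hΛm, hΛG, hΛP, hΛ⟩ :=
    hsol.exists_measurableSet_condLogLik_eq hcont hint hKL_int hKL_cont
  refine ⟨Λ, hΛm, hΛG, hΛP, fun s hs => ?_⟩
  have hmem : ∀ᵐ ω ∂P, ∀ n, 1 ≤ n → Rhat n ω ∈ M.Γ := ae_all_iff.2 fun n => by
    by_cases hn : 1 ≤ n
    · filter_upwards [hRhat n hn] with ω hω _ using hω.1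
    · exact Eventually.of_forall fun ω h => absurd h hn
  filter_upwards [h1, hmem] with ω hω hωmem
  have hev : ∀ᶠ n in atTop, Rhat n ω ∈ M.Γ :=
    (eventually_ge_atTop 1).mono fun n hn => hωmem n hn
  have hKL : Tendsto (fun n => M.condLogLik R₀ (Rhat n ω) s) atTop (𝓝 (M.condLogLik R₀ R₀ s)) :=
    MixedSeries.tendsto_of_tendsto_infDist hΓ (fun R hR => hR.1) ⟨R₀, hR₀⟩
      (hKL_cont s (hΛG hs)) (hΛ s hs) hev hω
  refine tendsto_order.2 ⟨fun a ha => Eventually.of_forall fun n =>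
    ha.trans_le (MixedSeries.tvDist_nonneg _ _), fun a ha => ?_⟩
  -- The Pinsker-type bound with `ε = a / 2`: the entropy term vanishes in the limit, which leaves
  -- `a / 2 < a`.
  have hlim : Tendsto (fun n => a / 2 + (a / 2)⁻¹ * (M.condLogLik R₀ R₀ s
      - M.condLogLik R₀ (Rhat n ω) s)) atTop (𝓝 (a / 2)) := by
    have := ((hKL.const_sub (M.condLogLik R₀ R₀ s)).const_mul (a / 2)⁻¹).const_add (a / 2)
    simpa using this
  filter_upwards [hlim.eventually_lt_const (half_lt_self ha), hev] with n hn hnΓ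
  exact (MixedSeries.Model.tvDist_condDist_le hsol.R₀_mem hnΓ (hΛG hs)
    (hKL_int s (hΛG hs) R₀ hsol.R₀_mem) (hKL_int s (hΛG hs) _ hnΓ) (half_pos ha)).trans_lt hn
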